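/- For a set $G\subset(1,\infty)$ of real numbers let $G(x)=|\{g\in G: g\le x\}|$, and let $b_0=1<b_1\le b_2\le\cdots$ be the Beurling integers generated by $G$, i.e. all finite products $\prod_{g\in G} g^{k_g}$ ($k_g\in\mathbb{Z}_{\ge0}$, almost all $0$) in nondecreasing order, listed with multiplicity (once for each choice of exponents). There exist a set $G\subset(1,\infty)$ of irrational numbers and a constant $c>0$ such that $G(x)>cx/\log x$ for all sufficiently large $x$, and $b_{i+1}-b_i\ge 1$ for all $i\ge 0$. More precisely, each of the following two sets is contained in $(1,\infty)$ and has these properties (with its own $c$): (a) $G=\{f(p)^2 : p \text{ prime},\ p\equiv\pm1\pmod 8\}$, where $f(p)$ is the least of the numbers $x+y\sqrt2$ with positive integers $x,y$ such that $x^2-2y^2=\pm p$; all elements of this set are irrational. (b) $G=\{e^{f(p)} : p\text{ prime},\ p\equiv1\pmod 4\}$, where, writing $p=a^2+b^2$ with integers $0<a<b$, $f(p)$ is the value of the argument of the Gaussian prime $b+ai$ (determined modulo $2\pi$) with $\log p<f(p)<\log p+2\pi$; all elements of this set are transcendental. -/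

import Mathlib

/-- The number of elements of `G` up to `x`, written `G(x)`. -/
noncomputable def countUpTo (G : Set ℝ) (x : ℝ) : ℕ :=
  {g : ℝ | g ∈ G ∧ g ≤ x}.ncard

/-- The product of generators (elements of `G`) with the given exponents. -/
noncomputable def generatorProduct (G : Set ℝ) (k : G →₀ ℕ) : ℝ :=
  k.prod fun g n => (g : ℝ) ^ n

/-- `b 0 ≤ b 1 ≤ b 2 ≤ ⋯` is the sequence of Beurling integers generated by `G`: the
nondecreasing sequence of all finite products of elements of `G` (the empty product included),
each listed once for every choice of exponents producing it. -/
def IsBeurlingSequence (G : Set ℝ) (b : ℕ → ℝ) : Prop :=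
  Monotone b ∧ ∃ e : ℕ ≃ (G →₀ ℕ), ∀ i, b i = generatorProduct G (e i)

/-- `G` is a set of generators (reals greater than `1`) with `G(x) > c x / log x` for some `c > 0`
and all large `x`, whose Beurling integers satisfy `b (i + 1) - b i ≥ 1` for all `i`. -/
structure IsDenseLacunary (G : Set ℝ) : Prop where
  one_lt : ∀ g ∈ G, 1 < g
  dense : ∃ c : ℝ, 0 < c ∧
    ∀ᶠ x : ℝ in Filter.atTop, (countUpTo G x : ℝ) > c * x / Real.log x
  lacunary : ∃ b : ℕ → ℝ, IsBeurlingSequence G b ∧ ∀ i, b (i + 1) - b i ≥ 1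

/-- The numbers `x + y √2` with positive integers `x, y` such that `x² - 2y² = ± p`. -/
def normRepresentations (p : ℕ) : Set ℝ :=
  {t | ∃ x y : ℤ, 0 < x ∧ 0 < y ∧ (x ^ 2 - 2 * y ^ 2 = p ∨ x ^ 2 - 2 * y ^ 2 = -(p : ℤ)) ∧
    t = x + y * √2}

/-- The squares `f(p)²`, for primes `p ≡ ± 1 (mod 8)`, where `f(p)` is the least number
`x + y √2` with positive integers `x, y` and `x² - 2y² = ± p`. -/
def quadraticGenerators : Set ℝ :=
  {g | ∃ (p : ℕ) (t : ℝ), p.Prime ∧ (p % 8 = 1 ∨ p % 8 = 7) ∧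
    IsLeast (normRepresentations p) t ∧ g = t ^ 2}

/-- The numbers `exp f(p)`, for primes `p ≡ 1 (mod 4)`, where, with `p = a² + b²`, `0 < a < b`,
`f(p)` is the value of the argument of the Gaussian prime `b + a i` (that is, the principal
argument plus a multiple of `2π`) satisfying `log p < f(p) < log p + 2π`. -/
def gaussianGenerators : Set ℝ :=
  {g | ∃ (p a b : ℕ) (k : ℤ) (f : ℝ), p.Prime ∧ p % 4 = 1 ∧ p = a ^ 2 + b ^ 2 ∧ 0 < a ∧ a < b ∧
    f = Complex.arg ((b : ℂ) + (a : ℂ) * Complex.I) + 2 * k * Real.pi ∧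
    Real.log p < f ∧ f < Real.log p + 2 * Real.pi ∧ g = Real.exp f}

/-!
Both sets are families of generators `g p` indexed by the primes `p` in a residue class (or two) on
which a real character takes the value `1`, with `p < g p ≤ C p`. Three facts are needed.

*Density.* `G(x) ≫ x / log x` reduces to a Chebyshev bound for the primes with `χ(p) = 1`, where `χ`
is the character modulo `4` or the even character modulo `8`. Mertens' argument gives
`∑ Λ(n) χ(n) / n = O(1)`, because the partial sums of `χ` are bounded and `L(1, χ) > 0`. Hence
`∑ (1 + χ(n)) Λ(n) / n = log N + O(1)`, and comparing the sums up to `N` and up to `A N` for a large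
constant `A` gives the bound (`IsNonvanishingRealCharacter.exists_le_card_primes`).

*Gaps.* If products of generators with different exponents differ by at least `1`, then the floor
function embeds them in `ℕ`, which produces the increasing enumeration (`isDenseLacunary_range`). For
the quadratic generators a product is `u²` with `u = x + y√2`, `x, y ≥ 0`; for `u ≠ v` the norm of
`u - v` is a nonzero integer and its conjugate is at most `u + v`, so `|u² - v²| ≥ 1`
(`one_le_abs_sq_sub_sq`). For the Gaussian generators a product is `exp Φ` with `Φ` a value of the
argument of a Gaussian integer `z` and `|z|² ≤ exp Φ`. For two such products the integer
`Im (z₁ conj z₂) = |z₁| |z₂| sin (Φ₁ - Φ₂)` is nonzero by unique factorization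
(`GaussianInt.finsupp_eq_of_im_eq_zero`), so `|z₁| |z₂| |Φ₁ - Φ₂| ≥ 1`, whence
`|exp Φ₁ - exp Φ₂| ≥ 1` (`GaussianInt.one_le_abs_exp_sub_exp`).

*Transcendence.* If `f` is a value of the argument of `b + a i`, then `exp (f i)` is algebraic, so
`exp f` is transcendental by the Gelfond–Schneider theorem for the exponent `i`
(`Complex.not_isAlgebraic_exp_mul_I`). This is proved by Schneider's method: the function
`∑ x_{ac} z ^ a exp (c lam z)` has values in a fixed number field at the points `m + n i`. The same
theorem shows that `f` can be chosen in the open interval `(log p, log p + 2π)`.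
-/

/-! ### Mertens and Chebyshev estimates twisted by a real character -/

section

open Finset in
/-- Summation by parts for bounded partial sums against decreasing weights. -/
theorem abs_sum_Ico_mul_le_of_antitoneOn {χ f : ℕ → ℝ} {B : ℝ} {a b : ℕ} (hab : a ≤ b)
    (hχ : ∀ c, |∑ i ∈ Ico a c, χ i| ≤ B) (hf : AntitoneOn f (Set.Ici a)) (hf0 : ∀ i, 0 ≤ f i) :
    |∑ i ∈ Ico a b, χ i * f i| ≤ B * f a := by
  have key : |∑ i ∈ Ico a b, χ i * f i - (∑ i ∈ Ico a b, χ i) * f b| ≤ B * (f a - f b) := by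
    induction b, hab using Nat.le_induction with
    | base => simp
    | succ b hab ih =>
      rw [sum_Ico_succ_top hab]
      have hT : ∑ i ∈ Ico a (b + 1), χ i = ∑ i ∈ Ico a b, χ i + χ b := sum_Ico_succ_top hab _
      have h1 : ∑ i ∈ Ico a b, χ i * f i + χ b * f b - (∑ i ∈ Ico a (b + 1), χ i) * f (b + 1)
          = (∑ i ∈ Ico a b, χ i * f i - (∑ i ∈ Ico a b, χ i) * f b)
            + (∑ i ∈ Ico a (b + 1), χ i) * (f b - f (b + 1)) := by rw [hT]; ring
      have h2 : 0 ≤ f b - f (b + 1) :=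
        sub_nonneg.2 (hf (by simpa using hab) (by simp; omega) (Nat.le_succ b))
      rw [h1]
      refine (abs_add_le _ _).trans ?_
      rw [abs_mul, abs_of_nonneg h2]
      have := mul_le_mul_of_nonneg_right (hχ (b + 1)) h2
      linarith
  have h3 : |(∑ i ∈ Ico a b, χ i) * f b| ≤ B * f b := by
    rw [abs_mul, abs_of_nonneg (hf0 b)]
    exact mul_le_mul_of_nonneg_right (hχ b) (hf0 b)
  calc |∑ i ∈ Ico a b, χ i * f i|
      = |(∑ i ∈ Ico a b, χ i * f i - (∑ i ∈ Ico a b, χ i) * f b) + (∑ i ∈ Ico a b, χ i) * f b| := by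
        ring_nf
    _ ≤ _ := abs_add_le _ _
    _ ≤ B * (f a - f b) + B * f b := add_le_add key h3
    _ = B * f a := by ring

/-- A completely multiplicative function `χ : ℕ → ℝ` that behaves like a nonprincipal real
Dirichlet character with `L(1, χ) ≠ 0`: it is bounded by `1`, its sums over intervals are bounded,
and infinitely many partial sums of `∑ χ(n) / n` exceed a fixed positive constant. -/
structure IsNonvanishingRealCharacter (χ : ℕ → ℝ) : Prop where
  mul : ∀ m n, χ (m * n) = χ m * χ n
  abs_le_one : ∀ n, |χ n| ≤ 1
  sum_le : ∃ B, ∀ a b, |∑ i ∈ Finset.Ico a b, χ i| ≤ B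
  pos : ∃ δ > 0, ∃ᶠ N in Filter.atTop, δ ≤ ∑ n ∈ Finset.Ioc 0 N, χ n / n

namespace IsNonvanishingRealCharacter

open Finset Filter ArithmeticFunction Topology

variable {χ : ℕ → ℝ}

/-- The series `∑ χ(n) / n` converges to `L = L(1, χ) > 0`, with tails `O(1 / N)`. -/
theorem exists_limit (h : IsNonvanishingRealCharacter χ) :
    ∃ L > 0, ∃ B ≥ 0, ∀ N : ℕ, |∑ n ∈ Ioc 0 N, χ n / n - L| ≤ B / (N + 1) := by
  obtain ⟨B, hB⟩ := h.sum_le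
  obtain ⟨δ, hδ, hpos⟩ := h.pos
  have hB0 : 0 ≤ B := (abs_nonneg _).trans (hB 0 0)
  set S : ℕ → ℝ := fun N ↦ ∑ n ∈ Ioc 0 N, χ n / n with hS
  have hdiff : ∀ N M, N ≤ M → |S M - S N| ≤ B / (N + 1) := by
    intro N M hNM
    have h1 : S M - S N = ∑ i ∈ Ico (N + 1) (M + 1), χ i * (1 / (i : ℝ)) := by
      have : ∑ n ∈ Ioc 0 N, χ n / n + ∑ n ∈ Ioc N M, χ n / n = ∑ n ∈ Ioc 0 M, χ n / n :=
        sum_Ioc_consecutive _ (Nat.zero_le _) hNM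
      have h2 : Ico (N + 1) (M + 1) = Ioc N M := by ext; simp
      simp only [hS, h2, mul_one_div]
      linarith
    rw [h1]
    refine (abs_sum_Ico_mul_le_of_antitoneOn (by omega) (fun c ↦ hB _ c) ?_ ?_).trans_eq ?_
    · intro i hi j hj hij
      simp only [Set.mem_Ici] at hi
      exact one_div_le_one_div_of_le (by exact_mod_cast (by omega : 0 < i)) (by exact_mod_cast hij)
    · intro i; positivity
    · push_cast; ring
  have hlim0 : Tendsto (fun N : ℕ ↦ B / ((N : ℝ) + 1)) atTop (𝓝 0) :=
    tendsto_const_nhds.div_atTop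
      (tendsto_atTop_add_const_right _ _ tendsto_natCast_atTop_atTop)
  have hC : CauchySeq S := by
    refine cauchySeq_of_le_tendsto_0' _ (fun n m hnm ↦ ?_) hlim0
    rw [Real.dist_eq, abs_sub_comm]
    exact hdiff n m hnm
  obtain ⟨L, hL⟩ := cauchySeq_tendsto_of_complete hC
  refine ⟨L, ?_, B, hB0, fun N ↦ ?_⟩
  · by_contra hneg
    have := hL.eventually (gt_mem_nhds (show L < δ by linarith))
    obtain ⟨N, hN, hN'⟩ := (hpos.and_eventually this).exists
    exact absurd hN' (not_lt.2 hN)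
  · have h1 : Tendsto (fun M ↦ |S N - S M|) atTop (𝓝 |S N - L|) :=
      (tendsto_const_nhds.sub hL).abs
    refine le_of_tendsto h1 ?_
    filter_upwards [eventually_ge_atTop N] with M hM
    rw [abs_sub_comm]
    exact hdiff N M hM

theorem abs_sum_log_div_le (h : IsNonvanishingRealCharacter χ) :
    ∃ C, ∀ N : ℕ, |∑ n ∈ Ioc 0 N, χ n * Real.log n / n| ≤ C := by
  obtain ⟨B, hB⟩ := h.sum_le
  have hB0 : 0 ≤ B := (abs_nonneg _).trans (hB 0 0)
  refine ⟨1 + B * 2, fun N ↦ ?_⟩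
  have hlog : ∀ i : ℕ, 0 ≤ Real.log i / i := fun i ↦
    div_nonneg (Real.log_natCast_nonneg i) (by positivity)
  have hlog1 : ∀ i : ℕ, Real.log i / i ≤ 1 := fun i ↦
    div_le_one_of_le₀ (Real.log_le_self (by positivity)) (by positivity)
  have hterm : ∀ i : ℕ, |χ i * (Real.log i / i)| ≤ 1 := fun i ↦ by
    rw [abs_mul, abs_of_nonneg (hlog i)]
    exact mul_le_one₀ (h.abs_le_one i) (hlog i) (hlog1 i)
  simp only [mul_div_assoc]
  have hI : Ioc 0 N = Ico 1 (N + 1) := by ext; simp; omega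
  rw [hI]
  rcases le_or_gt 3 (N + 1) with hN | hN
  · rw [← sum_Ico_consecutive _ (show 1 ≤ 3 by norm_num) hN]
    refine (abs_add_le _ _).trans (add_le_add ?_ ?_)
    · rw [show Ico 1 3 = {1, 2} from rfl, sum_pair (by norm_num)]
      simpa using hterm 2
    · refine (abs_sum_Ico_mul_le_of_antitoneOn hN (fun c ↦ hB _ c) ?_ hlog).trans ?_
      · intro i hi j hj hij
        simp only [Set.mem_Ici] at hi
        have h3 : Real.exp 1 ≤ (i : ℝ) := by
          have : (3 : ℝ) ≤ i := by exact_mod_cast hi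
          linarith [Real.exp_one_lt_d9]
        have hij' : (i : ℝ) ≤ j := by exact_mod_cast hij
        exact Real.log_div_self_antitoneOn h3 (h3.trans hij') hij'
      · exact mul_le_mul_of_nonneg_left (by linarith [hlog1 3]) hB0
  · have h2 : Ico 1 (N + 1) ⊆ {1} := by intro i; simp; omega
    have : ∑ i ∈ Ico 1 (N + 1), χ i * (Real.log i / i) = 0 := by
      refine sum_eq_zero fun i hi ↦ ?_
      have := h2 hi
      simp only [mem_singleton] at this
      simp [this]
    rw [this, abs_zero]; positivity

/-- The Dirichlet convolution identity `χ · log = (χ Λ) * χ`, divided by `n` and summed. -/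
theorem sum_log_div_eq (h : IsNonvanishingRealCharacter χ) (N : ℕ) :
    ∑ n ∈ Ioc 0 N, χ n * Real.log n / n =
      ∑ d ∈ Ioc 0 N, χ d * vonMangoldt d / d * ∑ m ∈ Ioc 0 (N / d), χ m / m := by
  obtain ⟨f, hf⟩ : ∃ f : ArithmeticFunction ℝ, ∀ n, f n = χ n * vonMangoldt n / n :=
    ⟨⟨fun n ↦ χ n * vonMangoldt n / n, by simp⟩, fun _ ↦ rfl⟩
  obtain ⟨g, hg⟩ : ∃ g : ArithmeticFunction ℝ, ∀ n, g n = χ n / n :=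
    ⟨⟨fun n ↦ χ n / n, by simp⟩, fun _ ↦ rfl⟩
  have h1 := ArithmeticFunction.sum_Ioc_mul_eq_sum_sum f g N
  simp only [hf, hg] at h1
  rw [← h1]
  refine sum_congr rfl fun n hn ↦ ?_
  rw [ArithmeticFunction.mul_apply, ← vonMangoldt_sum, ← Nat.sum_divisorsAntidiagonal (fun i _ ↦ Λ i),
    mul_sum, sum_div]
  refine sum_congr rfl fun x hx ↦ ?_
  rw [Nat.mem_divisorsAntidiagonal] at hx
  rw [hf, hg, ← hx.1, h.mul]
  push_cast
  field_simp

/-- Mertens' estimate for `χ`: replacing the inner sums in `sum_log_div_eq` by `L(1, χ)` costs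
`O(ψ(N) / N) = O(1)`, and `L(1, χ) ≠ 0`. -/
theorem abs_sum_vonMangoldt_div_le (h : IsNonvanishingRealCharacter χ) :
    ∃ C, ∀ N : ℕ, |∑ n ∈ Ioc 0 N, χ n * vonMangoldt n / n| ≤ C := by
  obtain ⟨L, hL, B, hB, hlim⟩ := h.exists_limit
  obtain ⟨C, hC⟩ := h.abs_sum_log_div_le
  refine ⟨(C + B * (Real.log 4 + 4)) / L, fun N ↦ ?_⟩
  rw [le_div_iff₀ hL]
  rcases Nat.eq_zero_or_pos N with rfl | hN
  · simp only [Ioc_self, sum_empty, abs_zero, zero_mul]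
    have := (abs_nonneg _).trans (hC 0)
    positivity
  have hN' : (0 : ℝ) < N := by exact_mod_cast hN
  have key : (∑ n ∈ Ioc 0 N, χ n * vonMangoldt n / n) * L =
      ∑ n ∈ Ioc 0 N, χ n * Real.log n / n -
      ∑ d ∈ Ioc 0 N, χ d * vonMangoldt d / d * (∑ m ∈ Ioc 0 (N / d), χ m / m - L) := by
    rw [h.sum_log_div_eq, ← sum_sub_distrib, sum_mul]
    exact sum_congr rfl fun _ _ ↦ by ring
  have hrem : |∑ d ∈ Ioc 0 N, χ d * vonMangoldt d / d * (∑ m ∈ Ioc 0 (N / d), χ m / m - L)|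
      ≤ B * (Real.log 4 + 4) := by
    have hpsi := Chebyshev.psi_le_const_mul_self (x := (N : ℝ)) (by positivity)
    rw [Chebyshev.psi, Nat.floor_natCast] at hpsi
    calc _ ≤ ∑ d ∈ Ioc 0 N, |χ d * vonMangoldt d / d * (∑ m ∈ Ioc 0 (N / d), χ m / m - L)| :=
          abs_sum_le_sum_abs _ _
      _ ≤ ∑ d ∈ Ioc 0 N, B / N * vonMangoldt d := by
          refine sum_le_sum fun d hd ↦ ?_
          rw [mem_Ioc] at hd
          have hd0 : (0 : ℝ) < d := by exact_mod_cast hd.1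
          rw [abs_mul, abs_div, abs_mul, abs_of_nonneg (vonMangoldt_nonneg (n := d)),
            abs_of_pos hd0]
          have h1 : |∑ m ∈ Ioc 0 (N / d), χ m / m - L| ≤ B * d / N := by
            refine (hlim _).trans ?_
            rw [div_le_div_iff₀ (by positivity) hN', mul_assoc]
            refine mul_le_mul_of_nonneg_left ?_ hB
            have : N < d * (N / d + 1) := Nat.lt_mul_div_succ N hd.1
            exact_mod_cast this.le
          calc |χ d| * vonMangoldt d / d * |∑ m ∈ Ioc 0 (N / d), χ m / m - L|
              ≤ 1 * vonMangoldt d / d * (B * d / N) := by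
                have := vonMangoldt_nonneg (n := d)
                gcongr
                exact h.abs_le_one d
            _ = B / N * vonMangoldt d := by field_simp
      _ = B / N * ∑ d ∈ Ioc 0 N, vonMangoldt d := by rw [mul_sum]
      _ ≤ B / N * ((Real.log 4 + 4) * N) := by gcongr
      _ = B * (Real.log 4 + 4) := by field_simp
  calc |∑ n ∈ Ioc 0 N, χ n * vonMangoldt n / n| * L
      = |(∑ n ∈ Ioc 0 N, χ n * vonMangoldt n / n) * L| := by rw [abs_mul, abs_of_pos hL]
    _ ≤ _ := by rw [key]; exact abs_sub _ _
    _ ≤ _ := add_le_add (hC N) hrem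

end IsNonvanishingRealCharacter

open Finset Filter ArithmeticFunction Topology

theorem Nat.log_factorial_eq_sum_vonMangoldt (N : ℕ) :
    Real.log (N.factorial : ℝ) = ∑ d ∈ Ioc 0 N, vonMangoldt d * (N / d : ℕ) := by
  rw [← ArithmeticFunction.sum_Ioc_mul_zeta_eq_sum, vonMangoldt_mul_zeta]
  induction N with
  | zero => simp
  | succ n ih =>
    rw [sum_Ioc_succ_top (Nat.zero_le n), ← ih, Nat.factorial_succ, Nat.cast_mul,
      Real.log_mul (by positivity) (by positivity), log_apply, add_comm]

/-- Mertens' estimate `∑ Λ(n) / n = log N + O(1)`. -/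
theorem abs_sum_vonMangoldt_div_sub_log_le :
    ∃ C, ∀ N : ℕ, 0 < N → |∑ n ∈ Ioc 0 N, vonMangoldt n / n - Real.log N| ≤ C := by
  refine ⟨Real.log 4 + 4, fun N hN ↦ ?_⟩
  have hN' : (0 : ℝ) < N := by exact_mod_cast hN
  have hN1 : (1 : ℝ) ≤ N := by exact_mod_cast hN
  have h4 : 0 < Real.log 4 := Real.log_pos (by norm_num)
  have hfac := Nat.log_factorial_eq_sum_vonMangoldt N
  have hpsi := Chebyshev.psi_le_const_mul_self (x := (N : ℝ)) (by positivity)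
  rw [Chebyshev.psi, Nat.floor_natCast] at hpsi
  have hlow : N * Real.log N - N ≤ Real.log (N.factorial : ℝ) := by
    have := Stirling.le_log_factorial_stirling hN.ne'
    have h1 : 0 ≤ Real.log N := Real.log_nonneg hN1
    have h2 : 0 ≤ Real.log (2 * Real.pi) := Real.log_nonneg (by linarith [Real.pi_gt_three])
    linarith
  have hup : Real.log (N.factorial : ℝ) ≤ N * Real.log N := by
    rw [← Real.log_pow]
    exact Real.log_le_log (by positivity) (by exact_mod_cast Nat.factorial_le_pow N)
  have h1 : Real.log (N.factorial : ℝ) ≤ N * ∑ n ∈ Ioc 0 N, vonMangoldt n / n := by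
    rw [hfac, mul_sum]
    refine sum_le_sum fun d hd ↦ ?_
    rw [mul_div_left_comm]
    exact mul_le_mul_of_nonneg_left Nat.cast_div_le vonMangoldt_nonneg
  have h2 : N * ∑ n ∈ Ioc 0 N, vonMangoldt n / n ≤
      Real.log (N.factorial : ℝ) + (Real.log 4 + 4) * N := by
    refine le_trans ?_ (add_le_add_right hpsi _)
    rw [hfac, mul_sum, ← sum_add_distrib]
    refine sum_le_sum fun d hd ↦ ?_
    rw [mem_Ioc] at hd
    have hd0 : (0 : ℝ) < d := by exact_mod_cast hd.1
    rw [mul_div_left_comm, ← mul_add_one]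
    refine mul_le_mul_of_nonneg_left ?_ vonMangoldt_nonneg
    rw [div_le_iff₀ hd0, mul_comm]
    exact_mod_cast (Nat.lt_mul_div_succ N hd.1).le
  rw [abs_le]
  constructor
  · refine le_of_mul_le_mul_left ?_ hN'
    nlinarith
  · refine le_of_mul_le_mul_left ?_ hN'
    nlinarith

/-- A Chebyshev-type lower bound for the primes on which a nonvanishing real character takes the
value `1`, obtained by comparing the logarithmic sums up to `M` and up to `A * M`. -/
theorem IsNonvanishingRealCharacter.exists_le_card_primes {χ : ℕ → ℝ}
    (h : IsNonvanishingRealCharacter χ) (hval : ∀ n, χ n = 1 ∨ χ n = -1 ∨ χ n = 0)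
    (hram : ∀ p, p.Prime → χ p = 0 → p = 2) :
    ∃ c > 0, ∀ᶠ N : ℕ in atTop,
      c * N / Real.log N ≤ #{p ∈ Ioc 0 N | p.Prime ∧ χ p = 1} := by
  obtain ⟨C₁, hC₁⟩ := h.abs_sum_vonMangoldt_div_le
  obtain ⟨C₂, hC₂⟩ := abs_sum_vonMangoldt_div_sub_log_le
  obtain ⟨K, hK⟩ := Chebyshev.psi_sub_theta_le_mul_sqrt
  have hχ : ∀ n, 0 ≤ 1 + χ n := fun n ↦ by linarith [(abs_le.1 (h.abs_le_one n)).1]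
  have hχ2 : ∀ n, 1 + χ n ≤ 2 := fun n ↦ by linarith [(abs_le.1 (h.abs_le_one n)).2]
  set C := C₁ + C₂
  have hW : ∀ N : ℕ, 0 < N → |∑ n ∈ Ioc 0 N, (1 + χ n) * vonMangoldt n / n - Real.log N| ≤ C := by
    intro N hN
    have : ∑ n ∈ Ioc 0 N, (1 + χ n) * vonMangoldt n / n - Real.log N =
        ∑ n ∈ Ioc 0 N, χ n * vonMangoldt n / n +
          (∑ n ∈ Ioc 0 N, vonMangoldt n / n - Real.log N) := by
      rw [add_sub, ← sum_add_distrib]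
      congr 1
      exact sum_congr rfl fun _ _ ↦ by ring
    rw [this]
    exact (abs_add_le _ _).trans (add_le_add (hC₁ N) (hC₂ N hN))
  obtain ⟨A, hA⟩ := exists_nat_ge (Real.exp (2 * C + 1))
  have hA0 : (0 : ℝ) < A := (Real.exp_pos _).trans_le hA
  have hA0' : 0 < A := by exact_mod_cast hA0
  have hlogA : 2 * C + 1 ≤ Real.log A := by
    rw [← Real.log_exp (2 * C + 1)]
    exact Real.log_le_log (Real.exp_pos _) hA
  -- The choice of `A` makes the logarithmic sum over `(M, A M]` at least `1`.
  have hM : ∀ M : ℕ, 0 < M → (M : ℝ) ≤ ∑ n ∈ Ioc 0 (A * M), (1 + χ n) * vonMangoldt n := by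
    intro M hM
    have hM' : (0 : ℝ) < M := by exact_mod_cast hM
    have hMA : M ≤ A * M := Nat.le_mul_of_pos_left M hA0'
    have h1 := (abs_le.1 (hW M hM)).2
    have h2 := (abs_le.1 (hW (A * M) (by positivity))).1
    rw [← sum_Ioc_consecutive _ (Nat.zero_le M) hMA, Nat.cast_mul,
      Real.log_mul hA0.ne' hM'.ne'] at h2
    have h3 : 1 ≤ ∑ n ∈ Ioc M (A * M), (1 + χ n) * vonMangoldt n / n := by linarith
    calc (M : ℝ) ≤ M * ∑ n ∈ Ioc M (A * M), (1 + χ n) * vonMangoldt n / n :=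
          le_mul_of_one_le_right hM'.le h3
      _ ≤ ∑ n ∈ Ioc M (A * M), (1 + χ n) * vonMangoldt n := by
          rw [mul_sum]
          refine sum_le_sum fun n hn ↦ ?_
          rw [mem_Ioc] at hn
          have hMn : (M : ℝ) ≤ n := by exact_mod_cast hn.1.le
          have h0 := mul_nonneg (hχ n) (vonMangoldt_nonneg (n := n))
          rw [mul_div_assoc', div_le_iff₀ (hM'.trans_le hMn), mul_comm]
          exact mul_le_mul_of_nonneg_left hMn h0
      _ ≤ _ := by
          refine sum_le_sum_of_subset_of_nonneg (Ioc_subset_Ioc_left (Nat.zero_le _)) ?_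
          intro n _ _
          exact mul_nonneg (hχ n) vonMangoldt_nonneg
  have hlow : ∀ N : ℕ, A ≤ N → (N : ℝ) / (2 * A) ≤
      ∑ n ∈ Ioc 0 N, (1 + χ n) * vonMangoldt n := by
    intro N hN
    have hpos : 0 < N / A := Nat.div_pos hN hA0'
    have h1 : (N : ℝ) / (2 * A) ≤ (N / A : ℕ) := by
      rw [div_le_iff₀ (by positivity)]
      have h2 : N < A * (N / A + 1) := Nat.lt_mul_div_succ N hA0'
      have h3 : N ≤ N / A * (2 * A) := by nlinarith
      exact_mod_cast h3
    refine h1.trans ((hM _ hpos).trans ?_)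
    refine sum_le_sum_of_subset_of_nonneg (Ioc_subset_Ioc_right (Nat.mul_div_le N A)) ?_
    intro n _ _
    exact mul_nonneg (hχ n) vonMangoldt_nonneg
  -- Prime powers contribute `O(√N)`, and the ramified prime `2` contributes `log 2`.
  have hup : ∀ N : ℕ, ∑ n ∈ Ioc 0 N, (1 + χ n) * vonMangoldt n ≤
      2 * (#{p ∈ Ioc 0 N | p.Prime ∧ χ p = 1} * Real.log N) + Real.log 2 + 2 * (K * √N) := by
    intro N
    rw [← sum_filter_add_sum_filter_not (Ioc 0 N) (fun n ↦ n.Prime)]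
    refine add_le_add ?_ ?_
    · have h1 : ∀ p ∈ {p ∈ Ioc 0 N | p.Prime}, (1 + χ p) * vonMangoldt p ≤
          (if χ p = 1 then 2 * Real.log N else 0) + (if p = 2 then Real.log 2 else 0) := by
        intro p hp
        rw [mem_filter, mem_Ioc] at hp
        have hp0 : (0 : ℝ) < p := by exact_mod_cast hp.1.1
        have hlogp : Real.log p ≤ Real.log N := Real.log_le_log hp0 (by exact_mod_cast hp.1.2)
        have hlog2 : 0 ≤ Real.log 2 := Real.log_nonneg (by norm_num)
        rw [vonMangoldt_apply_prime hp.2]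
        rcases hval p with h1 | h1 | h1
        · rw [if_pos h1, h1]
          split_ifs <;> linarith
        · rw [h1]
          have : 0 ≤ Real.log N := (Real.log_natCast_nonneg p).trans hlogp
          split_ifs <;> linarith
        · have h2 := hram p hp.2 h1
          rw [h1, if_neg (by norm_num), if_pos h2, h2]
          simp
      refine (sum_le_sum h1).trans ?_
      rw [sum_add_distrib]
      refine add_le_add ?_ ?_
      · rw [← sum_filter, filter_filter, sum_const, nsmul_eq_mul]
        exact le_of_eq (by ring)
      · rw [← sum_filter]
        have hsub : {p ∈ {p ∈ Ioc 0 N | p.Prime} | p = 2} ⊆ {2} := fun p hp ↦ by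
          simpa using (mem_filter.1 hp).2
        refine (sum_le_sum_of_subset_of_nonneg hsub ?_).trans_eq (sum_singleton _ _)
        intro _ _ _
        exact Real.log_nonneg (by norm_num)
    · have h1 := hK N
      rw [Chebyshev.psi_sub_theta_eq_sum_not_prime, Nat.floor_natCast] at h1
      refine le_trans ?_ (mul_le_mul_of_nonneg_left h1 zero_le_two)
      rw [mul_sum]
      exact sum_le_sum fun n _ ↦ mul_le_mul_of_nonneg_right (hχ2 n) vonMangoldt_nonneg
  refine ⟨1 / (8 * A), by positivity, ?_⟩
  have hsmall : ∀ᶠ N : ℕ in atTop, Real.log 2 + 2 * (K * √N) ≤ N / (4 * A) := by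
    have h1 : Tendsto (fun N : ℕ ↦ √(N : ℝ)) atTop atTop :=
      Real.tendsto_sqrt_atTop.comp tendsto_natCast_atTop_atTop
    filter_upwards [h1.eventually_ge_atTop (4 * A * (Real.log 2 + 2 * |K|)),
      h1.eventually_ge_atTop 1] with N hN hN1
    rw [le_div_iff₀ (by positivity)]
    have hsq : √(N : ℝ) * √N = N := Real.mul_self_sqrt (by positivity)
    have hlog2 : 0 ≤ Real.log 2 := Real.log_nonneg (by norm_num)
    have hKN : K * √N ≤ |K| * √N := by gcongr; exact le_abs_self K
    have h2 : Real.log 2 + 2 * (K * √N) ≤ (Real.log 2 + 2 * |K|) * √N := by nlinarith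
    calc _ ≤ (Real.log 2 + 2 * |K|) * √N * (4 * A) := by gcongr
      _ = 4 * A * (Real.log 2 + 2 * |K|) * √N := by ring
      _ ≤ √N * √N := by gcongr
      _ = N := hsq
  filter_upwards [hsmall, eventually_ge_atTop A, eventually_ge_atTop 2] with N hN hAN hN2
  have hlogN : 0 < Real.log N := Real.log_pos (by exact_mod_cast hN2)
  rw [div_le_iff₀ hlogN]
  have h1 := hlow N hAN
  have h2 := hup N
  have e1 : (N : ℝ) / (2 * A) = 4 * (1 / (8 * A) * N) := by field_simp; norm_num
  have e2 : (N : ℝ) / (4 * A) = 2 * (1 / (8 * A) * N) := by field_simp; norm_num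
  linarith

end

/-! ### The characters modulo 4 and modulo 8 -/

section

open Finset Filter

/-- The nonprincipal character modulo `4`, as a real function on `ℕ`. -/
noncomputable def realχ₄ (n : ℕ) : ℝ := (ZMod.χ₄ (n : ZMod 4) : ℤ)

/-- The even primitive character modulo `8`, as a real function on `ℕ`. -/
noncomputable def realχ₈ (n : ℕ) : ℝ := (ZMod.χ₈ (n : ZMod 8) : ℤ)

theorem realχ₄_eq (n : ℕ) :
    realχ₄ n = if n % 2 = 0 then 0 else if n % 4 = 1 then 1 else -1 := by
  rw [realχ₄, ZMod.χ₄_nat_eq_if_mod_four]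
  split_ifs <;> simp

theorem realχ₈_eq (n : ℕ) :
    realχ₈ n = if n % 2 = 0 then 0 else if n % 8 = 1 ∨ n % 8 = 7 then 1 else -1 := by
  rw [realχ₈, ZMod.χ₈_nat_eq_if_mod_eight]
  split_ifs <;> simp

theorem abs_sum_Ico_le_of_abs_sum_range_le {χ : ℕ → ℝ} {B : ℝ}
    (h : ∀ n, |∑ i ∈ range n, χ i| ≤ B) (a b : ℕ) : |∑ i ∈ Ico a b, χ i| ≤ 2 * B := by
  have hB : 0 ≤ B := (abs_nonneg _).trans (h 0)
  rcases le_total a b with hab | hab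
  · rw [sum_Ico_eq_sub _ hab, two_mul]
    exact (abs_sub _ _).trans (add_le_add (h b) (h a))
  · rw [Ico_eq_empty_of_le hab]
    simpa using hB

theorem sum_range_realχ₄ (n : ℕ) : ∑ i ∈ range n, realχ₄ i = if n % 4 ≤ 1 then 0 else 1 := by
  induction n with
  | zero => simp
  | succ n ih =>
    rw [sum_range_succ, ih, realχ₄_eq]
    have : n % 4 = 0 ∨ n % 4 = 1 ∨ n % 4 = 2 ∨ n % 4 = 3 := by omega
    have h2 : n % 2 = n % 4 % 2 := by omega
    rw [Nat.add_mod, h2]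
    rcases this with h | h | h | h <;> rw [h] <;> norm_num

theorem sum_range_realχ₈ (n : ℕ) : ∑ i ∈ range n, realχ₈ i =
    if n % 8 ≤ 1 then 0 else if n % 8 ≤ 3 then 1 else if n % 8 ≤ 5 then 0 else -1 := by
  induction n with
  | zero => simp
  | succ n ih =>
    rw [sum_range_succ, ih, realχ₈_eq]
    have : n % 8 = 0 ∨ n % 8 = 1 ∨ n % 8 = 2 ∨ n % 8 = 3 ∨ n % 8 = 4 ∨ n % 8 = 5 ∨
      n % 8 = 6 ∨ n % 8 = 7 := by omega
    have h2 : n % 2 = n % 8 % 2 := by omega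
    rw [Nat.add_mod, h2]
    rcases this with h | h | h | h | h | h | h | h <;> rw [h] <;> norm_num

/-- Each block of four terms contributes `1 / (4k + 1) - 1 / (4k + 3) > 0`. -/
theorem le_sum_realχ₄_div (k : ℕ) : 2 / 3 ≤ ∑ n ∈ Ioc 0 (4 * (k + 1)), realχ₄ n / n := by
  induction k with
  | zero =>
    rw [show Ioc 0 (4 * (0 + 1)) = {1, 2, 3, 4} from rfl]
    simp [realχ₄_eq]
    norm_num
  | succ k ih =>
    have e : 4 * (k + 1 + 1) = 4 * (k + 1) + 1 + 1 + 1 + 1 := by ring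
    rw [e]
    iterate 4 rw [sum_Ioc_succ_top (by omega)]
    generalize ∑ n ∈ Ioc 0 (4 * (k + 1)), realχ₄ n / n = s at ih ⊢
    simp only [realχ₄_eq]
    rw [if_neg (by omega), if_pos (by omega), if_pos (by omega), if_neg (by omega),
      if_neg (by omega), if_pos (by omega)]
    have : (1 : ℝ) / ((4 * (k + 1) + 2 + 1 : ℕ) : ℝ) ≤ 1 / ((4 * (k + 1) + 1 : ℕ) : ℝ) :=
      one_div_le_one_div_of_le (by positivity) (by push_cast; linarith)
    simp only [neg_div, zero_div]
    linarith

/-- Each later block of eight terms has a nonnegative sum, and the first exceeds `1 / 2`. -/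
theorem le_sum_realχ₈_div (k : ℕ) : 1 / 2 ≤ ∑ n ∈ Ioc 0 (8 * (k + 1)), realχ₈ n / n := by
  induction k with
  | zero =>
    rw [show Ioc 0 (8 * (0 + 1)) = {1, 2, 3, 4, 5, 6, 7, 8} from rfl]
    simp [realχ₈_eq]
    norm_num
  | succ k ih =>
    have e : 8 * (k + 1 + 1) = 8 * (k + 1) + 1 + 1 + 1 + 1 + 1 + 1 + 1 + 1 := by ring
    rw [e]
    iterate 8 rw [sum_Ioc_succ_top (by omega)]
    generalize ∑ n ∈ Ioc 0 (8 * (k + 1)), realχ₈ n / n = s at ih ⊢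
    simp only [realχ₈_eq]
    rw [if_neg (by omega), if_pos (by omega), if_pos (by omega), if_neg (by omega),
      if_neg (by omega), if_pos (by omega), if_neg (by omega), if_neg (by omega),
      if_pos (by omega), if_neg (by omega), if_pos (by omega), if_pos (by omega)]
    push_cast
    have hy : (0 : ℝ) ≤ 8 * (k + 1) := by positivity
    generalize (8 * ((k : ℝ) + 1)) = y at hy ih ⊢
    -- Pairing `1 / (y + 1) - 1 / (y + 3)` with `1 / (y + 7) - 1 / (y + 5)`: convexity of `1 / y`.
    have h1 : 1 / (y + 7) - 1 / (y + 5) ≥ -(2 / ((y + 5) * (y + 3))) := by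
      rw [ge_iff_le, div_sub_div _ _ (by positivity) (by positivity), ← neg_div,
        div_le_div_iff₀ (by positivity) (by positivity)]
      nlinarith [mul_nonneg hy hy, mul_nonneg (mul_nonneg hy hy) hy]
    have h2 : 1 / (y + 1) - 1 / (y + 3) ≥ 2 / ((y + 5) * (y + 3)) := by
      rw [ge_iff_le, div_sub_div _ _ (by positivity) (by positivity),
        div_le_div_iff₀ (by positivity) (by positivity)]
      nlinarith [mul_nonneg hy hy, mul_nonneg (mul_nonneg hy hy) hy]
    have e3 : y + 2 + 1 = y + 3 := by ring
    have e5 : y + 4 + 1 = y + 5 := by ring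
    have e7 : y + 6 + 1 = y + 7 := by ring
    simp only [e3, e5, e7, zero_div, neg_div]
    linarith

theorem isNonvanishingRealCharacter_realχ₄ : IsNonvanishingRealCharacter realχ₄ where
  mul m n := by simp only [realχ₄, Nat.cast_mul, map_mul, Int.cast_mul]
  abs_le_one n := by rw [realχ₄_eq]; split_ifs <;> simp
  sum_le := ⟨2 * 1, abs_sum_Ico_le_of_abs_sum_range_le fun n ↦ by
    rw [sum_range_realχ₄]; split_ifs <;> simp⟩
  pos := ⟨2 / 3, by norm_num, frequently_atTop.2 fun N ↦
    ⟨4 * (N + 1), by omega, le_sum_realχ₄_div N⟩⟩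

theorem isNonvanishingRealCharacter_realχ₈ : IsNonvanishingRealCharacter realχ₈ where
  mul m n := by simp only [realχ₈, Nat.cast_mul, map_mul, Int.cast_mul]
  abs_le_one n := by rw [realχ₈_eq]; split_ifs <;> simp
  sum_le := ⟨2 * 1, abs_sum_Ico_le_of_abs_sum_range_le fun n ↦ by
    rw [sum_range_realχ₈]; split_ifs <;> simp⟩
  pos := ⟨1 / 2, by norm_num, frequently_atTop.2 fun N ↦
    ⟨8 * (N + 1), by omega, le_sum_realχ₈_div N⟩⟩

theorem exists_le_card_primes_one_mod_four : ∃ c > 0, ∀ᶠ N : ℕ in atTop,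
    c * N / Real.log N ≤ #{p ∈ Ioc 0 N | p.Prime ∧ p % 4 = 1} := by
  obtain ⟨c, hc, h⟩ := isNonvanishingRealCharacter_realχ₄.exists_le_card_primes
    (fun n ↦ by rw [realχ₄_eq]; split_ifs <;> simp)
    (fun p hp h0 ↦ by
      rw [realχ₄_eq] at h0
      split_ifs at h0 with h1 h2
      · exact (hp.eq_one_or_self_of_dvd 2 (Nat.dvd_of_mod_eq_zero h1)).elim (by simp) Eq.symm
      · norm_num at h0
      · norm_num at h0)
  refine ⟨c, hc, h.mono fun N hN ↦ hN.trans ?_⟩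
  refine Nat.cast_le.2 (card_le_card (monotone_filter_right _ ?_))
  rintro p - ⟨hp, h1⟩
  refine ⟨hp, ?_⟩
  rw [realχ₄_eq] at h1
  split_ifs at h1 with h2 h3
  · norm_num at h1
  · exact h3
  · norm_num at h1

theorem exists_le_card_primes_one_or_seven_mod_eight : ∃ c > 0, ∀ᶠ N : ℕ in atTop,
    c * N / Real.log N ≤ #{p ∈ Ioc 0 N | p.Prime ∧ (p % 8 = 1 ∨ p % 8 = 7)} := by
  obtain ⟨c, hc, h⟩ := isNonvanishingRealCharacter_realχ₈.exists_le_card_primes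
    (fun n ↦ by rw [realχ₈_eq]; split_ifs <;> simp)
    (fun p hp h0 ↦ by
      rw [realχ₈_eq] at h0
      split_ifs at h0 with h1 h2
      · exact (hp.eq_one_or_self_of_dvd 2 (Nat.dvd_of_mod_eq_zero h1)).elim (by simp) Eq.symm
      · norm_num at h0
      · norm_num at h0)
  refine ⟨c, hc, h.mono fun N hN ↦ hN.trans ?_⟩
  refine Nat.cast_le.2 (card_le_card (monotone_filter_right _ ?_))
  rintro p - ⟨hp, h1⟩
  refine ⟨hp, ?_⟩
  rw [realχ₈_eq] at h1
  split_ifs at h1 with h2 h3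
  · norm_num at h1
  · exact h3
  · norm_num at h1

end

/-! ### Generators indexed by primes -/

section

open Finset Filter

/-- A family of nonnegative reals whose members are at distance at least `1` from each other can be
enumerated in increasing order. The floor function embeds the index set in `ℕ` compatibly with the
order. -/
theorem exists_equiv_nat_of_one_le_abs_sub {κ : Type*} [Infinite κ] {P : κ → ℝ}
    (h0 : ∀ k, 0 ≤ P k) (hsep : ∀ k l, k ≠ l → 1 ≤ |P k - P l|) :
    ∃ e : ℕ ≃ κ, ∀ i, P (e (i + 1)) - P (e i) ≥ 1 := by
  set φ : κ → ℕ := fun k ↦ ⌊P k⌋₊ with hφ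
  have hinj : Function.Injective φ := by
    intro k l hkl
    by_contra hne
    have h1 := hsep k l hne
    have hk := Nat.floor_le (h0 k)
    have hk' := Nat.lt_floor_add_one (P k)
    have hl := Nat.floor_le (h0 l)
    have hl' := Nat.lt_floor_add_one (P l)
    have hkl' : (⌊P k⌋₊ : ℝ) = ⌊P l⌋₊ := by exact_mod_cast hkl
    exact absurd h1 (not_le.2 (abs_lt.2 ⟨by linarith, by linarith⟩))
  have : Infinite (Set.range φ) := Set.infinite_coe_iff.2 (Set.infinite_range_of_injective hinj)
  classical
  let o : ℕ ≃o Set.range φ := Nat.Subtype.orderIsoOfNat (Set.range φ)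
  let e : ℕ ≃ κ := o.toEquiv.trans (Equiv.ofInjective φ hinj).symm
  have he : ∀ i, φ (e i) = o i := fun i ↦
    congrArg Subtype.val ((Equiv.ofInjective φ hinj).apply_symm_apply (o i))
  refine ⟨e, fun i ↦ ?_⟩
  have hlt : φ (e i) < φ (e (i + 1)) := by
    rw [he, he]
    exact o.strictMono (Nat.lt_succ_self i)
  have hP : P (e i) < P (e (i + 1)) := by
    by_contra hcon
    exact absurd hlt (not_lt.2 (Nat.floor_le_floor (not_lt.1 hcon)))
  have h1 := hsep (e (i + 1)) (e i) (e.injective.ne (by omega))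
  rwa [abs_of_pos (sub_pos.2 hP)] at h1

/-- A family of generators `g p ≍ p`, indexed by a set of integers of density at least that of the
primes, is dense and lacunary as soon as products with distinct exponents are at distance at least
`1`. The last condition also makes `g` injective. -/
theorem isDenseLacunary_range {P : ℕ → Prop} [DecidablePred P] {g : {p : ℕ // P p} → ℝ} {C : ℝ}
    (hP : ∀ p, P p → 0 < p) (hlow : ∀ p : {p : ℕ // P p}, (p : ℝ) < g p)
    (hup : ∀ p : {p : ℕ // P p}, g p ≤ C * p)
    (hcount : ∃ c > 0, ∀ᶠ N : ℕ in atTop, c * N / Real.log N ≤ #{p ∈ Ioc 0 N | P p})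
    (hsep : ∀ k l : {p : ℕ // P p} →₀ ℕ, k ≠ l →
      1 ≤ |(k.prod fun p n ↦ g p ^ n) - l.prod fun p n ↦ g p ^ n|) :
    IsDenseLacunary (Set.range g) := by
  have h1g : ∀ p, 1 < g p := fun p ↦ by
    have h1 : (1 : ℝ) ≤ (p : ℕ) := by exact_mod_cast hP p p.2
    exact h1.trans_lt (hlow p)
  have hinj : Function.Injective g := by
    intro p q hpq
    by_contra hne
    have := hsep (Finsupp.single p 1) (Finsupp.single q 1)
      (fun h ↦ hne (Finsupp.single_left_injective one_ne_zero h))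
    simp only [Finsupp.prod_single_index, pow_zero, hpq, sub_self, abs_zero] at this
    linarith
  obtain ⟨c, hc, hcount⟩ := hcount
  refine ⟨?_, ?_, ?_⟩
  · rintro _ ⟨p, rfl⟩
    exact h1g p
  · have hfin : ∀ x : ℝ, {y | y ∈ Set.range g ∧ y ≤ x}.Finite := by
      intro x
      have h1 : {p : {p : ℕ // P p} | g p ≤ x}.Finite := by
        refine Set.Finite.of_finite_image (f := Subtype.val)
          ((Set.finite_Iic ⌊x⌋₊).subset ?_) Subtype.val_injective.injOn
        rintro _ ⟨p, hp, rfl⟩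
        exact Nat.le_floor ((hlow p).le.trans hp)
      refine (h1.image g).subset ?_
      rintro _ ⟨⟨p, rfl⟩, hp⟩
      exact ⟨p, hp, rfl⟩
    set D : ℝ := max C 1 with hD
    have hD1 : 1 ≤ D := le_max_right _ _
    have hD0 : 0 < D := by linarith
    have hle : ∀ x : ℝ, 0 ≤ x → #{p ∈ Ioc 0 ⌊x / D⌋₊ | P p} ≤ countUpTo (Set.range g) x := by
      intro x hx
      rw [countUpTo, ← Set.ncard_coe_finset]
      refine Set.ncard_le_ncard_of_injOn (fun n ↦ if h : P n then g ⟨n, h⟩ else 0) ?_ ?_ (hfin x)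
      · intro n hn
        simp only [coe_filter, Set.mem_ofPred_eq, mem_Ioc] at hn
        simp only [dif_pos hn.2]
        refine ⟨⟨_, rfl⟩, (hup ⟨n, hn.2⟩).trans ?_⟩
        have h1 : (n : ℝ) ≤ x / D := (Nat.le_floor_iff (by positivity)).1 hn.1.2
        rw [le_div_iff₀ hD0] at h1
        calc C * n ≤ D * n := by gcongr; exact le_max_left _ _
          _ ≤ x := by linarith
      · intro n hn m hm hnm
        simp only [coe_filter, Set.mem_ofPred_eq] at hn hm
        simp only [dif_pos hn.2, dif_pos hm.2] at hnm
        exact congrArg Subtype.val (hinj hnm)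
    refine ⟨c / (4 * D), by positivity, ?_⟩
    have ht : Tendsto (fun x : ℝ ↦ ⌊x / D⌋₊) atTop atTop :=
      tendsto_nat_floor_atTop.comp (tendsto_id.atTop_div_const hD0)
    filter_upwards [ht.eventually hcount, ht.eventually_ge_atTop 2, eventually_ge_atTop 2]
      with x hx h2 hx2
    have hx0 : 0 < x := by linarith
    have hlogx : 0 < Real.log x := Real.log_pos (by linarith)
    have h2' : (2 : ℝ) ≤ ⌊x / D⌋₊ := by exact_mod_cast h2
    have hlog2 : 0 < Real.log ⌊x / D⌋₊ := Real.log_pos (by linarith)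
    have hfl : (⌊x / D⌋₊ : ℝ) ≤ x := (Nat.floor_le (by positivity)).trans (div_le_self hx0.le hD1)
    have hlog : Real.log ⌊x / D⌋₊ ≤ Real.log x := Real.log_le_log (by linarith) hfl
    have hbig : x / (4 * D) < ⌊x / D⌋₊ := by
      have h3 := Nat.lt_floor_add_one (x / D)
      have h4 : x / (4 * D) = x / D / 4 := by field_simp
      rw [h4]; linarith
    calc c / (4 * D) * x / Real.log x = c * (x / (4 * D)) / Real.log x := by ring
      _ < c * ⌊x / D⌋₊ / Real.log x := by gcongr
      _ ≤ c * ⌊x / D⌋₊ / Real.log ⌊x / D⌋₊ := by gcongr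
      _ ≤ _ := hx
      _ ≤ _ := by exact_mod_cast hle x hx0.le
  · have hne : Nonempty (Set.range g) := by
      obtain ⟨N, hN, hN2⟩ := (hcount.and (eventually_ge_atTop 2)).exists
      have hN2' : (2 : ℝ) ≤ N := by exact_mod_cast hN2
      have hlog : 0 < Real.log N := Real.log_pos (by linarith)
      have : (0 : ℝ) < #{p ∈ Ioc 0 N | P p} := hN.trans_lt' (by positivity)
      obtain ⟨p, hp⟩ := card_pos.1 (Nat.cast_pos.1 this)
      exact ⟨⟨_, ⟨p, (mem_filter.1 hp).2⟩, rfl⟩⟩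
    let E := Equiv.ofInjective g hinj
    have hprod : ∀ k : Set.range g →₀ ℕ, generatorProduct (Set.range g) k =
        (k.equivMapDomain E.symm).prod fun p n ↦ g p ^ n := by
      intro k
      rw [Finsupp.prod_equivMapDomain, generatorProduct]
      refine Finsupp.prod_congr fun a _ ↦ ?_
      have : g (E.symm a) = a := congrArg Subtype.val (E.apply_symm_apply a)
      rw [this]
    obtain ⟨e, he⟩ := exists_equiv_nat_of_one_le_abs_sub (P := generatorProduct (Set.range g))
      (fun k ↦ by
        rw [hprod]
        exact prod_nonneg fun p _ ↦ pow_nonneg (zero_le_one.trans (h1g p).le) _)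
      (fun k l hkl ↦ by
        rw [hprod, hprod]
        refine hsep _ _ fun h ↦ hkl ?_
        exact (Finsupp.equivCongrLeft E.symm).injective h)
    refine ⟨fun i ↦ generatorProduct (Set.range g) (e i),
      ⟨monotone_nat_of_le_succ fun i ↦ ?_, e, fun _ ↦ rfl⟩, he⟩
    linarith [he i]

end

/-! ### The generators from `ℤ[√2]` -/

section

open Finset Filter

theorem Int.two_ne_mul_self (n : ℤ) : (2 : ℤ) ≠ n * n := by
  intro h
  have h1 : n < 2 := by nlinarith
  have h2 : -2 < n := by nlinarith
  interval_cases n <;> omega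

/-- The embedding `x + y√2 ↦ x + y√2` of `ℤ[√2]` into `ℝ`. -/
noncomputable def sqrtTwoEmb : ℤ√2 →+* ℝ := Zsqrtd.toReal (by norm_num : (0 : ℤ) ≤ 2)

theorem sqrtTwoEmb_apply (u : ℤ√2) : sqrtTwoEmb u = u.re + u.im * √2 := by
  change (u.re : ℝ) + u.im * √((2 : ℤ) : ℝ) = _
  norm_num

theorem norm_eq_sqrtTwoEmb_mul (u : ℤ√2) :
    (u.norm : ℝ) = sqrtTwoEmb u * sqrtTwoEmb (star u) := by
  rw [← map_mul, ← Zsqrtd.norm_eq_mul_conj, map_intCast]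

/-- The elements `x + y√2` of `ℤ[√2]` with `x, y ≥ 0`, as a multiplicative submonoid. -/
def sqrtTwoCone : Submonoid (ℤ√2) where
  carrier := {u | 0 ≤ u.re ∧ 0 ≤ u.im}
  one_mem' := by simp
  mul_mem' := by
    rintro u v ⟨hu, hu'⟩ ⟨hv, hv'⟩
    constructor
    · rw [Zsqrtd.re_mul]; positivity
    · rw [Zsqrtd.im_mul]; positivity

/-- On the cone, the conjugate `x - y√2` is at most `x + y√2` in absolute value. -/
theorem abs_sqrtTwoEmb_star_le {u : ℤ√2} (hu : u ∈ sqrtTwoCone) :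
    |sqrtTwoEmb (star u)| ≤ sqrtTwoEmb u := by
  have h1 : (0 : ℝ) ≤ u.re := by exact_mod_cast hu.1
  have h2 : (0 : ℝ) ≤ u.im * √2 := mul_nonneg (by exact_mod_cast hu.2) (Real.sqrt_nonneg _)
  rw [sqrtTwoEmb_apply, sqrtTwoEmb_apply, Zsqrtd.re_star, Zsqrtd.im_star, abs_le]
  push_cast
  constructor <;> linarith

/-- Squares of distinct elements `u, v` of the cone are at distance at least `1`: the norm of
`u - v` is a nonzero integer, and the conjugate of `u - v` is at most `u + v`. -/
theorem one_le_abs_sq_sub_sq {u v : ℤ√2} (hu : u ∈ sqrtTwoCone) (hv : v ∈ sqrtTwoCone)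
    (huv : u ≠ v) : 1 ≤ |sqrtTwoEmb u ^ 2 - sqrtTwoEmb v ^ 2| := by
  have hN : (u - v).norm ≠ 0 := fun h ↦
    huv (sub_eq_zero.1 ((Zsqrtd.norm_eq_zero Int.two_ne_mul_self _).1 h))
  have h1 : (1 : ℝ) ≤ |((u - v).norm : ℝ)| := by exact_mod_cast Int.one_le_abs hN
  rw [norm_eq_sqrtTwoEmb_mul, abs_mul, star_sub, map_sub, map_sub] at h1
  have h2 : |sqrtTwoEmb (star u) - sqrtTwoEmb (star v)| ≤ sqrtTwoEmb u + sqrtTwoEmb v :=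
    (abs_sub _ _).trans (add_le_add (abs_sqrtTwoEmb_star_le hu) (abs_sqrtTwoEmb_star_le hv))
  have h3 : 0 ≤ sqrtTwoEmb u + sqrtTwoEmb v := (abs_nonneg _).trans h2
  calc 1 ≤ |sqrtTwoEmb u - sqrtTwoEmb v| * |sqrtTwoEmb (star u) - sqrtTwoEmb (star v)| := h1
    _ ≤ |sqrtTwoEmb u - sqrtTwoEmb v| * (sqrtTwoEmb u + sqrtTwoEmb v) := by gcongr
    _ = |sqrtTwoEmb u ^ 2 - sqrtTwoEmb v ^ 2| := by
      rw [sq_sub_sq, abs_mul, abs_of_nonneg h3, mul_comm]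

/-- Unique factorization for exponent vectors indexed by a set of primes. -/
theorem finsupp_prod_prime_pow_injective {P : ℕ → Prop} (hP : ∀ p, P p → p.Prime) :
    Function.Injective fun k : {p : ℕ // P p} →₀ ℕ ↦ k.prod fun p n ↦ (p : ℕ) ^ n := by
  intro k l hkl
  have h : ∀ k : {p : ℕ // P p} →₀ ℕ,
      (k.prod fun p n ↦ (p : ℕ) ^ n).factorization = k.mapDomain Subtype.val := by
    intro k
    rw [← Finsupp.prod_mapDomain_index_inj (h := fun p n ↦ p ^ n) Subtype.val_injective]
    refine Nat.prod_pow_factorization_eq_self fun p hp ↦ ?_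
    classical
    obtain ⟨q, -, rfl⟩ := Finset.mem_image.1 (Finsupp.mapDomain_support hp)
    exact hP _ q.2
  refine Finsupp.mapDomain_injective Subtype.val_injective ?_
  rw [← h, ← h]
  exact congrArg _ hkl

/-- Thue's lemma, applied to a square root of `2` modulo `p`. -/
theorem exists_sq_sub_two_mul_sq_eq_neg {p : ℕ} (hp : p.Prime) (h8 : p % 8 = 1 ∨ p % 8 = 7) :
    ∃ x y : ℤ, 0 < x ∧ 0 < y ∧ x ^ 2 < p ∧ y ^ 2 < p ∧ x ^ 2 - 2 * y ^ 2 = -(p : ℤ) := by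
  have : Fact p.Prime := ⟨hp⟩
  have hp2 : p ≠ 2 := by omega
  obtain ⟨r, hr⟩ := (ZMod.exists_sq_eq_two_iff hp2).2 h8
  set m := Nat.sqrt p with hm
  obtain ⟨a, b, hab, hf⟩ := Fintype.exists_ne_map_eq_of_card_lt
    (fun a : Fin (m + 1) × Fin (m + 1) ↦ ((a.1 : ℕ) : ZMod p) - r * ((a.2 : ℕ) : ZMod p)) (by
      rw [ZMod.card, Fintype.card_prod, Fintype.card_fin]
      exact Nat.lt_succ_sqrt p)
  set x : ℤ := ((a.1 : ℕ) : ℤ) - ((b.1 : ℕ) : ℤ) with hx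
  set y : ℤ := ((a.2 : ℕ) : ℤ) - ((b.2 : ℕ) : ℤ) with hy
  have hsq : ∀ z : ℤ, -(m : ℤ) ≤ z → z ≤ m → z ^ 2 < p := by
    intro z h1 h2
    have h3 : z ^ 2 ≤ (m : ℤ) ^ 2 := sq_le_sq' h1 h2
    have h4 : m ^ 2 ≤ p := Nat.sqrt_le' p
    have h4' : (m : ℤ) ^ 2 ≤ p := by exact_mod_cast h4
    refine lt_of_le_of_ne (h3.trans h4') fun h ↦ ?_
    have h5 : z.natAbs ^ 2 = p := by
      zify; rw [sq_abs]; exact h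
    exact hp.prime.not_isSquare ⟨z.natAbs, by rw [← sq]; exact h5.symm⟩
  have hx2 : x ^ 2 < p := hsq x (by have := b.1.2; omega) (by have := a.1.2; omega)
  have hy2 : y ^ 2 < p := hsq y (by have := b.2.2; omega) (by have := a.2.2; omega)
  have hxy : (x : ZMod p) = r * y := by
    simp only [hx, hy]
    push_cast
    linear_combination hf
  have hdvd : (p : ℤ) ∣ x ^ 2 - 2 * y ^ 2 := by
    rw [← ZMod.intCast_zmod_eq_zero_iff_dvd]
    push_cast
    rw [hxy, hr]; ring
  have hne : x ^ 2 - 2 * y ^ 2 ≠ 0 := by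
    intro h0
    have h1 : (⟨x, y⟩ : ℤ√2).norm = 0 := by rw [Zsqrtd.norm_def]; linarith
    have h2 := (Zsqrtd.norm_eq_zero Int.two_ne_mul_self _).1 h1
    have hx0 : x = 0 := congrArg Zsqrtd.re h2
    have hy0 : y = 0 := congrArg Zsqrtd.im h2
    refine hab (Prod.ext (Fin.ext ?_) (Fin.ext ?_)) <;> omega
  have heq : x ^ 2 - 2 * y ^ 2 = -(p : ℤ) := by
    obtain ⟨c, hc⟩ := hdvd
    have hp0 : (0 : ℤ) < p := by exact_mod_cast hp.pos
    have h1 : c < 1 := by nlinarith [sq_nonneg y]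
    have h2 : -2 < c := by nlinarith [sq_nonneg x]
    have h3 : c ≠ 0 := by rintro rfl; exact hne (by rw [hc, mul_zero])
    have : c = -1 := by omega
    rw [hc, this]; ring
  have hx0 : x ≠ 0 := by
    intro h0
    rw [h0] at heq
    omega
  have hy0 : y ≠ 0 := by
    intro h0
    rw [h0] at heq
    have : (0 : ℤ) < p := by exact_mod_cast hp.pos
    nlinarith [sq_nonneg x]
  exact ⟨|x|, |y|, abs_pos.2 hx0, abs_pos.2 hy0, by rwa [sq_abs], by rwa [sq_abs],
    by rwa [sq_abs, sq_abs]⟩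

theorem exists_isLeast_normRepresentations {p : ℕ} (hp : p.Prime) (h8 : p % 8 = 1 ∨ p % 8 = 7) :
    ∃ t, IsLeast (normRepresentations p) t ∧ t ^ 2 ≤ 6 * p := by
  obtain ⟨x₀, y₀, hx₀, hy₀, hx₀p, hy₀p, heq₀⟩ := exists_sq_sub_two_mul_sq_eq_neg hp h8
  set t₀ : ℝ := x₀ + y₀ * √2 with ht₀
  have hmem₀ : t₀ ∈ normRepresentations p := ⟨x₀, y₀, hx₀, hy₀, Or.inr heq₀, rfl⟩
  have h1s : (1 : ℝ) ≤ √2 := Real.one_le_sqrt.2 (by norm_num)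
  have hfin : (normRepresentations p ∩ Set.Iic t₀).Finite := by
    refine ((Set.finite_Icc ((0 : ℤ), (0 : ℤ)) (⌊t₀⌋, ⌊t₀⌋)).image
      fun a ↦ (a.1 : ℝ) + a.2 * √2).subset ?_
    rintro _ ⟨⟨x, y, hx, hy, -, rfl⟩, hle⟩
    rw [Set.mem_Iic] at hle
    have hx' : (0 : ℝ) < x := by exact_mod_cast hx
    have hy' : (0 : ℝ) < y := by exact_mod_cast hy
    refine ⟨(x, y), ⟨⟨hx.le, hy.le⟩, Int.le_floor.2 ?_, Int.le_floor.2 ?_⟩, rfl⟩ <;> nlinarith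
  obtain ⟨t, ⟨htmem, htle⟩, hmin⟩ := Set.exists_min_image _ id hfin ⟨t₀, hmem₀, Set.mem_Iic.2 le_rfl⟩
  refine ⟨t, ⟨htmem, fun s hs ↦ ?_⟩, ?_⟩
  · rcases le_total s t₀ with h | h
    · exact hmin s ⟨hs, h⟩
    · exact htle.trans h
  · have ht0 : 0 ≤ t := by
      obtain ⟨x, y, hx, hy, -, rfl⟩ := htmem
      have hx' : (0 : ℝ) < x := by exact_mod_cast hx
      have hy' : (0 : ℝ) < y := by exact_mod_cast hy
      positivity
    have h1 : t ^ 2 ≤ t₀ ^ 2 := pow_le_pow_left₀ ht0 htle 2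
    refine h1.trans ?_
    have hs : √2 * √2 = (2 : ℝ) := Real.mul_self_sqrt (by norm_num)
    have hxp : (x₀ : ℝ) ^ 2 < p := by exact_mod_cast hx₀p
    have hyp : (y₀ : ℝ) ^ 2 < p := by exact_mod_cast hy₀p
    -- Cauchy–Schwarz: `(x + y√2)² ≤ 3 (x² + y²)`.
    have h3 : t₀ ^ 2 = 3 * (x₀ ^ 2 + y₀ ^ 2) - (√2 * x₀ - y₀) ^ 2 := by
      simp only [ht₀]; linear_combination ((y₀ : ℝ) ^ 2 + (x₀ : ℝ) ^ 2) * hs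
    nlinarith [sq_nonneg (√2 * x₀ - y₀)]

/-- A representative in `ℤ[√2]` of the least number `x + y√2` attached to `p`. -/
theorem exists_zsqrtd_of_isLeast {p : ℕ} {t : ℝ} (ht : IsLeast (normRepresentations p) t) :
    ∃ u : ℤ√2, 0 < u.re ∧ 0 < u.im ∧ u.norm.natAbs = p ∧ sqrtTwoEmb u = t := by
  obtain ⟨x, y, hx, hy, h, rfl⟩ := ht.1
  refine ⟨⟨x, y⟩, hx, hy, ?_, sqrtTwoEmb_apply _⟩
  have e : (⟨x, y⟩ : ℤ√2).norm = x ^ 2 - 2 * y ^ 2 := by rw [Zsqrtd.norm_def]; ring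
  rw [e]
  rcases h with h | h <;> rw [h] <;> simp

theorem irrational_sqrtTwoEmb_sq {u : ℤ√2} (hx : 0 < u.re) (hy : 0 < u.im) :
    Irrational (sqrtTwoEmb u ^ 2) := by
  rw [← map_pow, sqrtTwoEmb_apply]
  have him : (u ^ 2).im ≠ 0 := by
    rw [sq, Zsqrtd.im_mul]; positivity
  exact (irrational_sqrt_two.intCast_mul him).intCast_add _

theorem lt_sqrtTwoEmb_sq {u : ℤ√2} (hx : 0 < u.re) (hy : 0 < u.im) :
    (u.norm.natAbs : ℝ) < sqrtTwoEmb u ^ 2 := by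
  have hx' : (0 : ℝ) < u.re := by exact_mod_cast hx
  have hy' : (0 : ℝ) < u.im := by exact_mod_cast hy
  rw [Nat.cast_natAbs, Int.cast_abs, norm_eq_sqrtTwoEmb_mul, abs_mul, sq]
  have hs : 0 < √2 := Real.sqrt_pos.2 (by norm_num)
  have h0 : 0 < sqrtTwoEmb u := by rw [sqrtTwoEmb_apply]; positivity
  rw [abs_of_pos h0]
  refine mul_lt_mul_of_pos_left ?_ h0
  rw [sqrtTwoEmb_apply, sqrtTwoEmb_apply, Zsqrtd.re_star, Zsqrtd.im_star, abs_lt]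
  push_cast
  have := mul_pos hy' hs
  constructor <;> linarith

theorem quadraticGenerators_irrational : ∀ g ∈ quadraticGenerators, Irrational g := by
  rintro _ ⟨p, t, -, -, ht, rfl⟩
  obtain ⟨u, hx, hy, -, rfl⟩ := exists_zsqrtd_of_isLeast ht
  exact irrational_sqrtTwoEmb_sq hx hy

theorem isDenseLacunary_quadraticGenerators : IsDenseLacunary quadraticGenerators := by
  have hex : ∀ p : {p : ℕ // p.Prime ∧ (p % 8 = 1 ∨ p % 8 = 7)}, ∃ u : ℤ√2,
      0 < u.re ∧ 0 < u.im ∧ u.norm.natAbs = p ∧ IsLeast (normRepresentations p) (sqrtTwoEmb u) ∧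
        sqrtTwoEmb u ^ 2 ≤ 6 * (p : ℕ) := by
    rintro ⟨p, hp, h8⟩
    obtain ⟨t, ht, htp⟩ := exists_isLeast_normRepresentations hp h8
    obtain ⟨u, hx, hy, hN, rfl⟩ := exists_zsqrtd_of_isLeast ht
    exact ⟨u, hx, hy, hN, ht, htp⟩
  choose u hx hy hN hleast hup using hex
  have hrange : quadraticGenerators = Set.range fun p ↦ sqrtTwoEmb (u p) ^ 2 := by
    ext g
    constructor
    · rintro ⟨p, t, hp, h8, ht, rfl⟩
      exact ⟨⟨p, hp, h8⟩, by simp only [(hleast ⟨p, hp, h8⟩).unique ht]⟩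
    · rintro ⟨p, rfl⟩
      exact ⟨p, _, p.2.1, p.2.2, hleast p, rfl⟩
  rw [hrange]
  refine isDenseLacunary_range (fun p hp ↦ hp.1.pos) (fun p ↦ ?_) hup
    exists_le_card_primes_one_or_seven_mod_eight fun k l hkl ↦ ?_
  · have := lt_sqrtTwoEmb_sq (hx p) (hy p)
    rwa [hN] at this
  · set U : ({p : ℕ // p.Prime ∧ (p % 8 = 1 ∨ p % 8 = 7)} →₀ ℕ) → ℤ√2 :=
      fun k ↦ k.prod fun p n ↦ u p ^ n with hU
    have hprod : ∀ k, (k.prod fun p n ↦ (sqrtTwoEmb (u p) ^ 2) ^ n) = sqrtTwoEmb (U k) ^ 2 := by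
      intro k
      simp only [hU, Finsupp.prod, map_prod, map_pow, ← Finset.prod_pow]
      exact prod_congr rfl fun _ _ ↦ by ring
    have hnorm : ∀ k, (U k).norm.natAbs = k.prod fun p n ↦ (p : ℕ) ^ n := by
      intro k
      have h1 : (U k).norm = Zsqrtd.normMonoidHom (U k) := rfl
      rw [h1]
      simp only [hU, Finsupp.prod, map_prod, map_pow]
      rw [← Int.natAbsHom_apply, map_prod]
      refine prod_congr rfl fun p _ ↦ ?_
      rw [map_pow, Int.natAbsHom_apply]
      exact congrArg (· ^ _) (hN p)
    have hmem : ∀ k, U k ∈ sqrtTwoCone := fun k ↦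
      sqrtTwoCone.prod_mem fun p _ ↦ sqrtTwoCone.pow_mem ⟨(hx p).le, (hy p).le⟩ _
    rw [hprod, hprod]
    refine one_le_abs_sq_sub_sq (hmem k) (hmem l) fun h ↦ hkl ?_
    refine finsupp_prod_prime_pow_injective (fun p hp ↦ hp.1) ?_
    simp only [← hnorm, h]

end

/-! ### A Schwarz lemma for entire functions with prescribed zeros -/

section

open Finset Filter

theorem Differentiable.exists_eq_prod_sub_mul {F : ℂ → ℂ} (hF : Differentiable ℂ F)
    {Z : Finset ℂ} (hZ : ∀ ζ ∈ Z, F ζ = 0) :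
    ∃ G : ℂ → ℂ, Differentiable ℂ G ∧ ∀ z, F z = (∏ ζ ∈ Z, (z - ζ)) * G z := by
  induction Z using Finset.induction_on generalizing F with
  | empty => exact ⟨F, hF, by simp⟩
  | insert a s ha ih =>
    have hd : Differentiable ℂ (dslope F a) := by
      rw [← differentiableOn_univ, Complex.differentiableOn_dslope univ_mem]
      exact hF.differentiableOn
    have heq : ∀ z, F z = (z - a) * dslope F a z := fun z ↦ by
      have := sub_smul_dslope F a z
      rw [hZ a (mem_insert_self _ _), sub_zero, smul_eq_mul] at this
      exact this.symm
    obtain ⟨G, hG, hGeq⟩ := ih hd fun ζ hζ ↦ by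
      have h1 := heq ζ
      rw [hZ ζ (mem_insert_of_mem hζ)] at h1
      exact (mul_eq_zero.1 h1.symm).resolve_left
        (sub_ne_zero.2 fun h ↦ ha (h ▸ hζ))
    exact ⟨G, hG, fun z ↦ by rw [heq, hGeq, prod_insert ha, mul_assoc]⟩

/-- Schwarz lemma: dividing out the zeros in the disc of radius `r` and applying the maximum principle
on the disc of radius `R` gains a factor `2r / (R - r)` per zero. -/
theorem Differentiable.norm_le_of_zeros {F : ℂ → ℂ} (hF : Differentiable ℂ F) {Z : Finset ℂ}
    {r R M : ℝ} (hr : 0 ≤ r) (hrR : r < R) (hZ : ∀ ζ ∈ Z, F ζ = 0) (hZr : ∀ ζ ∈ Z, ‖ζ‖ ≤ r)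
    (hM : ∀ w, ‖w‖ ≤ R → ‖F w‖ ≤ M) {z : ℂ} (hz : ‖z‖ ≤ r) :
    ‖F z‖ ≤ M * (2 * r / (R - r)) ^ #Z := by
  obtain ⟨G, hG, hFG⟩ := hF.exists_eq_prod_sub_mul hZ
  have hRr : 0 < R - r := sub_pos.2 hrR
  have hR : R ≠ 0 := by linarith
  have hGz : ‖G z‖ ≤ M / (R - r) ^ #Z := by
    refine Complex.norm_le_of_forall_mem_frontier_norm_le (U := Metric.ball (0 : ℂ) R)
      Metric.isBounded_ball hG.diffContOnCl ?_ (subset_closure ?_)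
    · intro w hw
      rw [frontier_ball _ hR, mem_sphere_zero_iff_norm] at hw
      rw [le_div_iff₀ (by positivity)]
      refine le_trans ?_ (hM w hw.le)
      rw [hFG w, norm_mul, norm_prod, mul_comm, ← prod_const]
      refine mul_le_mul_of_nonneg_right (prod_le_prod (fun _ _ ↦ hRr.le) fun ζ hζ ↦ ?_)
        (norm_nonneg _)
      have h1 := norm_sub_norm_le w ζ
      have h2 := hZr ζ hζ
      linarith
    · rw [mem_ball_zero_iff]; linarith
  have hprod : ∏ ζ ∈ Z, ‖z - ζ‖ ≤ (2 * r) ^ #Z := by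
    rw [← prod_const]
    refine prod_le_prod (fun _ _ ↦ norm_nonneg _) fun ζ hζ ↦ ?_
    have h1 := norm_sub_le z ζ
    have h2 := hZr ζ hζ
    linarith
  rw [hFG z, norm_mul, norm_prod]
  calc (∏ ζ ∈ Z, ‖z - ζ‖) * ‖G z‖ ≤ (2 * r) ^ #Z * (M / (R - r) ^ #Z) := by gcongr
    _ = M * (2 * r / (R - r)) ^ #Z := by rw [div_pow]; ring

/-! ### Exponential polynomials -/

/-- The exponential polynomial `∑ x_{ac} z ^ a exp (c lam z)`. -/
noncomputable def expPoly {A B : ℕ} (lam : ℂ) (x : Fin A × Fin B → ℂ) (z : ℂ) : ℂ :=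
  ∑ l, x l * (z ^ (l.1 : ℕ) * Complex.exp ((l.2 : ℕ) * lam * z))

theorem differentiable_expPoly {A B : ℕ} (lam : ℂ) (x : Fin A × Fin B → ℂ) :
    Differentiable ℂ (expPoly lam x) := by
  unfold expPoly
  fun_prop

theorem norm_expPoly_le {A B : ℕ} {lam : ℂ} {x : Fin A × Fin B → ℂ} {X ρ : ℝ} {z : ℂ}
    (hx : ∀ l, ‖x l‖ ≤ X) (hρ : 1 ≤ ρ) (hz : ‖z‖ ≤ ρ) :
    ‖expPoly lam x z‖ ≤ (A * B : ℕ) * (X * (ρ ^ A * Real.exp (B * ‖lam‖ * ρ))) := by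
  unfold expPoly
  refine (norm_sum_le_of_le (f := fun l ↦ x l * (z ^ (l.1 : ℕ) *
    Complex.exp ((l.2 : ℕ) * lam * z))) _ (n := fun _ ↦ X * (ρ ^ A * Real.exp (B * ‖lam‖ * ρ)))
    fun l _ ↦ ?_).trans_eq ?_
  · rw [norm_mul, norm_mul, norm_pow, Complex.norm_exp]
    have hX : 0 ≤ X := (norm_nonneg _).trans (hx l)
    have h1 : ‖z‖ ^ (l.1 : ℕ) ≤ ρ ^ A :=
      (pow_le_pow_left₀ (norm_nonneg _) hz _).trans (pow_le_pow_right₀ hρ l.1.2.le)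
    have h2 : (((l.2 : ℕ) : ℂ) * lam * z).re ≤ B * ‖lam‖ * ρ := by
      refine (Complex.re_le_norm _).trans ?_
      rw [norm_mul, norm_mul, Complex.norm_natCast]
      have : ((l.2 : ℕ) : ℝ) ≤ B := by exact_mod_cast l.2.2.le
      gcongr
    gcongr
    exact hx l
  · rw [sum_const, card_univ, Fintype.card_prod, Fintype.card_fin, Fintype.card_fin, nsmul_eq_mul]

/-- The functions `z ^ a exp (c lam z)` are linearly independent. Adding multiples of the period
`2πi / lam` to `z` separates the powers of `z`, and then `exp (lam z)` takes every nonzero value. -/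
theorem eq_zero_of_expPoly_eq_zero {A B : ℕ} {lam : ℂ} (hlam : lam ≠ 0) {x : Fin A × Fin B → ℂ}
    (h : ∀ z, expPoly lam x z = 0) : x = 0 := by
  classical
  set τ : ℂ := 2 * Real.pi * Complex.I / lam with hτ
  have hτ0 : τ ≠ 0 := div_ne_zero Complex.two_pi_I_ne_zero hlam
  have hper : ∀ (z : ℂ) (c k : ℕ),
      Complex.exp (c * lam * (z + k * τ)) = Complex.exp (c * lam * z) := by
    intro z c k
    have : c * lam * (z + k * τ) = c * lam * z + (c * k : ℕ) * (2 * Real.pi * Complex.I) := by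
      rw [hτ]; push_cast; field_simp
    rw [this, Complex.exp_add, Complex.exp_nat_mul_two_pi_mul_I, mul_one]
  -- For fixed `z`, the polynomial with coefficients `∑ c, x (a, c) exp (c lam z)` has infinitely
  -- many roots.
  have hcoef : ∀ (z : ℂ) (a : Fin A), ∑ c : Fin B, x (a, c) * Complex.exp ((c : ℕ) * lam * z) = 0 := by
    intro z
    set P : Polynomial ℂ := ∑ a : Fin A, Polynomial.C
      (∑ c : Fin B, x (a, c) * Complex.exp ((c : ℕ) * lam * z)) * Polynomial.X ^ (a : ℕ) with hP
    have hP0 : P = 0 := by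
      refine Polynomial.eq_zero_of_infinite_isRoot P ?_
      refine (Set.infinite_range_of_injective (f := fun k : ℕ ↦ z + k * τ) ?_).mono ?_
      · intro k l hkl
        exact_mod_cast mul_right_cancel₀ hτ0 (add_left_cancel hkl)
      · rintro _ ⟨k, rfl⟩
        have h1 := h (z + k * τ)
        simp only [expPoly, hper, Fintype.sum_prod_type] at h1
        change Polynomial.eval _ P = 0
        rw [hP, Polynomial.eval_finsetSum, ← h1]
        refine sum_congr rfl fun a _ ↦ ?_
        rw [Polynomial.eval_mul, Polynomial.eval_C, Polynomial.eval_pow, Polynomial.eval_X, sum_mul]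
        exact sum_congr rfl fun c _ ↦ by ring
    intro a
    have h2 := congrArg (fun Q ↦ Polynomial.coeff Q (a : ℕ)) hP0
    simp only [hP, Polynomial.finsetSum_coeff, Polynomial.coeff_C_mul_X_pow,
      Polynomial.coeff_zero, Fin.val_inj] at h2
    simpa using h2
  ext ⟨a, c⟩
  set Q : Polynomial ℂ := ∑ c : Fin B, Polynomial.C (x (a, c)) * Polynomial.X ^ (c : ℕ) with hQ
  have hQ0 : Q = 0 := by
    refine Polynomial.eq_zero_of_infinite_isRoot Q ?_
    refine (Set.infinite_range_of_injective (f := fun k : ℕ ↦ ((k : ℂ) + 1)) ?_).mono ?_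
    · intro k l hkl
      exact_mod_cast add_right_cancel hkl
    · rintro _ ⟨k, rfl⟩
      have hk : (k : ℂ) + 1 ≠ 0 := by exact_mod_cast Nat.succ_ne_zero k
      have h1 := hcoef (Complex.log (k + 1) / lam) a
      change Polynomial.eval _ Q = 0
      rw [hQ, Polynomial.eval_finsetSum, ← h1]
      refine sum_congr rfl fun c _ ↦ ?_
      have e : ((c : ℕ) : ℂ) * lam * (Complex.log (k + 1) / lam) = (c : ℕ) * Complex.log (k + 1) := by
        field_simp
      rw [Polynomial.eval_mul, Polynomial.eval_C, Polynomial.eval_pow, Polynomial.eval_X, e,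
        Complex.exp_nat_mul, Complex.exp_log hk]
  have h2 := congrArg (fun Q ↦ Polynomial.coeff Q (c : ℕ)) hQ0
  simp only [hQ, Polynomial.finsetSum_coeff, Polynomial.coeff_C_mul_X_pow,
    Polynomial.coeff_zero, Fin.val_inj] at h2
  simpa using h2

/-! ### Heights in number fields -/

open NumberField

/-- Liouville's inequality: a nonzero algebraic integer with all conjugates at most `H` is not too
small, since its norm is a nonzero integer. -/
theorem NumberField.one_le_norm_mul_pow {K : Type*} [Field K] [NumberField K] {x : 𝓞 K}
    (hx : x ≠ 0) {H : ℝ} (hH : ∀ τ : K →+* ℂ, ‖τ x‖ ≤ H) (σ : K →+* ℂ) :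
    1 ≤ ‖σ x‖ * H ^ Module.finrank ℚ K := by
  have hhouse : house (x : K) ≤ H := by
    rw [house, canonicalEmbedding.norm_le_iff]
    exact hH
  have h1 : 1 ≤ house (x : K) :=
    one_le_house_of_isIntegral x.2 (by exact_mod_cast hx)
  have h2 := norm_norm_le_norm_mul_house_pow (x : K) σ
  have h3 : (1 : ℝ) ≤ ‖Algebra.norm ℚ (x : K)‖ := by
    rw [← Algebra.coe_norm_int, ← Rat.norm_cast_real]
    have : Algebra.norm ℤ x ≠ 0 := Algebra.norm_ne_zero_iff.2 hx
    have := Int.one_le_abs this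
    simp only [Rat.cast_intCast, Real.norm_eq_abs]
    exact_mod_cast this
  refine (h3.trans h2).trans ?_
  gcongr ‖σ x‖ * ?_
  calc house (x : K) ^ (Module.finrank ℚ K - 1) ≤ house (x : K) ^ Module.finrank ℚ K :=
        pow_le_pow_right₀ h1 (Nat.sub_le _ _)
    _ ≤ H ^ Module.finrank ℚ K := pow_le_pow_left₀ (house_nonneg _) hhouse _

/-- Siegel's lemma over the ring of integers, for twice as many unknowns as equations. -/
theorem NumberField.exists_siegel (K : Type*) [Field K] [NumberField K] :
    ∃ C : ℝ, 1 ≤ C ∧ ∀ (α β : Type) [Fintype α] [Fintype β] (a : Matrix α β (𝓞 K)) (A : ℝ),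
      0 < Fintype.card α → Fintype.card β = 2 * Fintype.card α → 1 ≤ A →
      (∀ k l, ∀ τ : K →+* ℂ, ‖τ (a k l)‖ ≤ A) →
      ∃ ξ : β → 𝓞 K, ξ ≠ 0 ∧ a.mulVec ξ = 0 ∧
        ∀ l, ∀ τ : K →+* ℂ, ‖τ (ξ l)‖ ≤ C ^ 2 * Fintype.card β * A := by
  classical
  have key : ∃ c : ℝ, ∀ (α β : Type) [Fintype α] [Fintype β] (a : Matrix α β (𝓞 K)) (A : ℝ),
      a ≠ 0 → 0 < Fintype.card α → Fintype.card α < Fintype.card β →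
      (∀ k l, house ((algebraMap (𝓞 K) K) (a k l)) ≤ A) →
      ∃ ξ : β → 𝓞 K, ξ ≠ 0 ∧ a.mulVec ξ = 0 ∧ ∀ l, house (ξ l).1 ≤
        c * (c * Fintype.card β * A) ^
          ((Fintype.card α : ℝ) / (Fintype.card β - Fintype.card α)) :=
    ⟨_, fun α β _ _ a A ha hp hpq hA ↦
      house.exists_ne_zero_int_vec_house_le K a ha hp hpq rfl hA rfl⟩
  obtain ⟨c, hc⟩ := key
  refine ⟨max |c| 1, le_max_right _ _, fun α β _ _ a A hα hβ hA1 hA ↦ ?_⟩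
  have hC1 : 1 ≤ max |c| 1 := le_max_right _ _
  have hβ1 : (1 : ℝ) ≤ Fintype.card β := by
    have : 1 ≤ Fintype.card β := by omega
    exact_mod_cast this
  by_cases ha : a = 0
  · have hne : Nonempty β := Fintype.card_pos_iff.1 (by omega)
    refine ⟨1, one_ne_zero, by rw [ha, Matrix.zero_mulVec], fun l τ ↦ ?_⟩
    simp only [Pi.one_apply, map_one, norm_one]
    have : 1 ≤ max |c| 1 ^ 2 := one_le_pow₀ hC1
    nlinarith [mul_le_mul this hβ1 zero_le_one (by positivity)]
  · obtain ⟨ξ, hξ, hmul, hb⟩ := hc α β a A ha hα (by omega) fun k l ↦ by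
      rw [house, canonicalEmbedding.norm_le_iff]
      exact hA k l
    refine ⟨ξ, hξ, hmul, fun l τ ↦ (norm_embedding_le_house _ τ).trans ((hb l).trans ?_)⟩
    have hα0 : (0 : ℝ) < Fintype.card α := by exact_mod_cast hα
    have hexp : (Fintype.card α : ℝ) / (Fintype.card β - Fintype.card α) = 1 := by
      rw [hβ]; push_cast; rw [two_mul, add_sub_cancel_right, div_self hα0.ne']
    rw [hexp, Real.rpow_one]
    have : c ^ 2 ≤ max |c| 1 ^ 2 := by
      rw [← sq_abs]; gcongr; exact le_max_left _ _
    calc c * (c * Fintype.card β * A) = c ^ 2 * Fintype.card β * A := by ring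
      _ ≤ _ := by gcongr

end

/-! ### The Gelfond–Schneider theorem for the exponent `i` -/

section

open Finset Filter NumberField

/-- The growth comparison that drives the extrapolation: for `N ≤ √S` the quantity
`S ^ (O(N S))` is smaller than `3 ^ (S²)`. -/
theorem exists_pow_mul_lt_three_pow (κ : ℝ) (hκ : 1 ≤ κ) (w : ℕ) :
    ∃ S₀ : ℕ, ∀ S ≥ S₀, ∀ N : ℕ, N ^ 2 ≤ S →
      ((14 * κ * S) ^ (N * S)) ^ w * S < (3 : ℝ) ^ (S * S) := by
  have hlim : Tendsto (fun S : ℕ ↦ 14 * κ * (S : ℝ)) atTop atTop :=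
    tendsto_natCast_atTop_atTop.const_mul_atTop (by positivity)
  have hlo := (isLittleO_log_rpow_atTop (r := 1 / 2) (by norm_num)).comp_tendsto hlim
  have hε : 0 < 1 / (((w : ℝ) + 2) * √(14 * κ)) := by positivity
  obtain ⟨S₀, hS₀⟩ := eventually_atTop.1 (hlo.def hε)
  refine ⟨max S₀ 1, fun S hS N hN ↦ ?_⟩
  have hS1 : 1 ≤ S := (le_max_right _ _).trans hS
  have hS1' : (1 : ℝ) ≤ S := by exact_mod_cast hS1
  have hS0 : (0 : ℝ) < S := by linarith
  have hb := hS₀ S ((le_max_left _ _).trans hS)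
  simp only [Function.comp, Real.norm_eq_abs] at hb
  have hbase : S ≤ 14 * κ * (S : ℝ) := by nlinarith
  set L := Real.log (14 * κ * S) with hL
  have hL0 : 0 ≤ L := Real.log_nonneg (by linarith)
  have hlogS : Real.log S ≤ L := Real.log_le_log hS0 hbase
  rw [← Real.sqrt_eq_rpow, abs_of_nonneg hL0, abs_of_nonneg (Real.sqrt_nonneg _),
    Real.sqrt_mul (show 0 ≤ 14 * κ by positivity)] at hb
  have hLS : (w + 2) * L ≤ √(S : ℝ) := by
    have hpos : 0 < √(14 * κ) := Real.sqrt_pos.2 (by positivity)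
    calc (w + 2) * L ≤ (w + 2) * (1 / (((w : ℝ) + 2) * √(14 * κ)) * (√(14 * κ) * √S)) := by gcongr
      _ = √(S : ℝ) := by field_simp
  have hNS : (N : ℝ) ≤ √(S : ℝ) := Real.le_sqrt_of_sq_le (by exact_mod_cast hN)
  have hsS : 1 ≤ √(S : ℝ) := Real.one_le_sqrt.2 hS1'
  have hss : √(S : ℝ) * √S = S := Real.mul_self_sqrt hS0.le
  rw [← Real.log_lt_log_iff (by positivity) (by positivity),
    Real.log_mul (by positivity) (by positivity), Real.log_pow, Real.log_pow, Real.log_pow, ← hL]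
  push_cast
  have hlog3 : 1 < Real.log 3 := by
    rw [Real.lt_log_iff_exp_lt (by norm_num)]
    linarith [Real.exp_one_lt_d9]
  have h1 : (w : ℝ) * (N * S * L) ≤ w * (√S * S * L) := by gcongr
  have h2 : L ≤ √S * S * L := by
    have : 1 ≤ √(S : ℝ) * S := one_le_mul_of_one_le_of_one_le hsS hS1'
    exact le_mul_of_one_le_left hL0 this
  calc (w : ℝ) * (N * S * L) + Real.log S
      ≤ √S * S * ((w + 2) * L) := by nlinarith
    _ ≤ √S * S * √S := by gcongr
    _ = S * S := by rw [mul_right_comm, hss]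
    _ < S * S * Real.log 3 := lt_mul_of_one_lt_right (by positivity) hlog3

section

variable {K : Type*} [Field K] [NumberField K]

/-- The algebraic integer `d ^ D (m + n i) ^ a γ ^ (c m) α ^ (c n)`, where `u = d γ`, `v = d α` and
`J = i`; here `D` is any exponent at least `c (m + n)`. -/
def latticeValue (u v J : 𝓞 K) (d D m n a c : ℕ) : 𝓞 K :=
  (m + n * J) ^ a * (u ^ (c * m) * v ^ (c * n) * d ^ (D - c * m - c * n))

theorem map_latticeValue {σ : K →+* ℂ} {u v J : 𝓞 K} {d D m n a c : ℕ} {lam : ℂ}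
    (hJ : σ J = Complex.I) (hu : σ u = d * Complex.exp lam)
    (hv : σ v = d * Complex.exp (lam * Complex.I)) (hD : c * m + c * n ≤ D) :
    σ (latticeValue u v J d D m n a c) = d ^ D * (((m : ℂ) + n * Complex.I) ^ a *
      Complex.exp (c * lam * (m + n * Complex.I))) := by
  have h1 : (d : ℂ) ^ D = d ^ (c * m) * d ^ (c * n) * d ^ (D - c * m - c * n) := by
    rw [← pow_add, ← pow_add]; congr 1; omega
  have h2 : Complex.exp (c * lam * (m + n * Complex.I)) =
      Complex.exp lam ^ (c * m) * Complex.exp (lam * Complex.I) ^ (c * n) := by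
    rw [← Complex.exp_nat_mul, ← Complex.exp_nat_mul, ← Complex.exp_add]
    push_cast; ring_nf
  rw [latticeValue]
  simp only [map_mul, map_pow, map_add, map_natCast, hJ, hu, hv, mul_pow]
  rw [h1, h2]
  ring

theorem norm_map_latticeValue_le {τ : K →+* ℂ} {u v J : 𝓞 K} {d D m n a c A S : ℕ} {κ : ℝ}
    (hJ : J ^ 2 = -1) (hu : ‖τ u‖ ≤ κ) (hv : ‖τ v‖ ≤ κ) (hd : d ≤ κ)
    (hD : c * m + c * n ≤ D) (hm : m ≤ S) (hn : n ≤ S) (hS : 1 ≤ S) (ha : a ≤ A) :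
    ‖τ (latticeValue u v J d D m n a c)‖ ≤ (2 * S) ^ A * κ ^ D := by
  have hJ1 : ‖τ J‖ = 1 := by
    have h1 : (τ J) ^ 2 = -1 := by
      have := congrArg (fun x : 𝓞 K ↦ τ (x : K)) hJ
      simpa using this
    have h2 : ‖τ J‖ ^ 2 = 1 := by rw [← norm_pow, h1, norm_neg, norm_one]
    exact (pow_eq_one_iff_of_nonneg (norm_nonneg _) two_ne_zero).1 h2
  have hκ : 0 ≤ κ := (norm_nonneg _).trans hu
  have hm' : (m : ℝ) ≤ S := by exact_mod_cast hm
  have hn' : (n : ℝ) ≤ S := by exact_mod_cast hn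
  have hS' : (1 : ℝ) ≤ S := by exact_mod_cast hS
  have h1 : ‖(m : ℂ) + n * τ J‖ ≤ 2 * S := by
    refine (norm_add_le _ _).trans ?_
    rw [norm_mul, Complex.norm_natCast, Complex.norm_natCast, hJ1]
    linarith
  have h2 : κ ^ D = κ ^ (c * m) * κ ^ (c * n) * κ ^ (D - c * m - c * n) := by
    rw [← pow_add, ← pow_add]; congr 1; omega
  rw [latticeValue]
  simp only [map_mul, map_pow, map_add, map_natCast, norm_mul, norm_pow, Complex.norm_natCast]
  rw [h2]
  have h3 : ‖(m : ℂ) + n * τ J‖ ^ a ≤ (2 * S) ^ A :=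
    (pow_le_pow_left₀ (norm_nonneg _) h1 _).trans (pow_le_pow_right₀ (by linarith) ha)
  gcongr

end

/-- The lattice points `m + n i` with `0 ≤ m, n < S`. -/
noncomputable def latticeSquare (S : ℕ) : Finset ℂ :=
  (range S ×ˢ range S).image fun a ↦ (a.1 : ℂ) + a.2 * Complex.I

theorem card_latticeSquare (S : ℕ) : #(latticeSquare S) = S * S := by
  rw [latticeSquare, card_image_of_injective, card_product, card_range]
  intro a b hab
  have h1 := congrArg Complex.re hab
  have h2 := congrArg Complex.im hab
  simp at h1 h2
  exact Prod.ext h1 h2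

theorem norm_latticePoint_le {m n S : ℕ} (hm : m ≤ S) (hn : n ≤ S) :
    ‖(m : ℂ) + n * Complex.I‖ ≤ 2 * S := by
  refine (norm_add_le _ _).trans ?_
  rw [norm_mul, Complex.norm_natCast, Complex.norm_natCast, Complex.norm_I]
  have hm' : (m : ℝ) ≤ S := by exact_mod_cast hm
  have hn' : (n : ℝ) ≤ S := by exact_mod_cast hn
  linarith

/-- The Schwarz lemma for functions vanishing on a square of lattice points. -/
theorem Differentiable.norm_le_of_latticeSquare {F : ℂ → ℂ} (hF : Differentiable ℂ F) {S : ℕ}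
    (hS : 1 ≤ S) (hzero : ∀ m < S, ∀ n < S, F ((m : ℂ) + n * Complex.I) = 0) {M : ℝ}
    (hM : ∀ w, ‖w‖ ≤ 14 * S → ‖F w‖ ≤ M) {z : ℂ} (hz : ‖z‖ ≤ 2 * S) :
    ‖F z‖ ≤ M / 3 ^ (S * S) := by
  have hS' : (1 : ℝ) ≤ S := by exact_mod_cast hS
  refine (hF.norm_le_of_zeros (Z := latticeSquare S) (r := 2 * S) (R := 14 * S) (by positivity)
    (by linarith) ?_ ?_ hM hz).trans_eq ?_
  · intro ζ hζ
    obtain ⟨a, ha, rfl⟩ := mem_image.1 hζ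
    rw [mem_product, mem_range, mem_range] at ha
    exact hzero _ ha.1 _ ha.2
  · intro ζ hζ
    obtain ⟨a, ha, rfl⟩ := mem_image.1 hζ
    rw [mem_product, mem_range, mem_range] at ha
    exact norm_latticePoint_le ha.1.le ha.2.le
  · have : 2 * (2 * (S : ℝ)) / (14 * S - 2 * S) = 1 / 3 := by field_simp; norm_num
    rw [this, card_latticeSquare, one_div, inv_pow, div_eq_mul_inv]

/-- Schneider's argument: `exp lam` and `exp (lam i)` cannot both lie in a number field `K`
containing `i`. Siegel's lemma gives an exponential polynomial with small coefficients that vanishes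
on a square of lattice points; its values at further lattice points are small by the Schwarz lemma,
while a nonzero algebraic integer of bounded height is not, so it vanishes on larger and larger
squares and finally everywhere. -/
theorem NumberField.false_of_map_eq_exp {K : Type*} [Field K] [NumberField K] {σ : K →+* ℂ}
    {u v J : 𝓞 K} {d : ℕ} {lam : ℂ} (hlam : lam ≠ 0)
    (hJ : σ J = Complex.I) (hu : σ u = d * Complex.exp lam)
    (hv : σ v = d * Complex.exp (lam * Complex.I)) (hd : 0 < d) : False := by
  have hJ2 : J ^ 2 = -1 := by
    refine RingOfIntegers.ext (σ.injective ?_)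
    simp [hJ]
  obtain ⟨C, hC1, hsiegel⟩ := NumberField.exists_siegel K
  obtain ⟨κ, hκC, hκu, hκv, hκd, hκl⟩ : ∃ κ : ℝ, C ≤ κ ∧ house (u : K) ≤ κ ∧ house (v : K) ≤ κ ∧
      d ≤ κ ∧ Real.exp ‖lam‖ ≤ κ := by
    refine ⟨C + house (u : K) + house (v : K) + d + Real.exp ‖lam‖, ?_, ?_, ?_, ?_, ?_⟩ <;>
    linarith [house_nonneg (u : K), house_nonneg (v : K), Nat.cast_nonneg (α := ℝ) d,
      Real.exp_pos ‖lam‖]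
  have hκ1 : 1 ≤ κ := hC1.trans hκC
  have hκ0 : 0 ≤ κ := by linarith
  have hκu' : ∀ τ : K →+* ℂ, ‖τ u‖ ≤ κ := fun τ ↦ (norm_embedding_le_house _ τ).trans hκu
  have hκv' : ∀ τ : K →+* ℂ, ‖τ v‖ ≤ κ := fun τ ↦ (norm_embedding_le_house _ τ).trans hκv
  set h := Module.finrank ℚ K with hh
  -- The exponent is that of the final comparison: `4 + 40` for the small value of the algebraic
  -- integer, and `16` for each conjugate.
  obtain ⟨S₀, hS₀⟩ := exists_pow_mul_lt_three_pow κ hκ1 (44 + 16 * h)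
  -- With `N ^ 3` powers of `z` and `2 N` exponentials there are twice as many coefficients as there
  -- are conditions at the points of a square of side `N ^ 2`, and degree and exponents balance.
  set N := S₀ + 1 with hN
  have hN1 : 1 ≤ N := by omega
  set A := N ^ 3 with hA
  set B := 2 * N with hB
  have hAB : A * B = 2 * N ^ 4 := by rw [hA, hB]; ring
  -- The common measure of all quantities below.
  set T : ℕ → ℝ := fun S ↦ (14 * κ * S) ^ (N * S) with hT
  have hbase : ∀ S : ℕ, N ^ 2 ≤ S → 1 ≤ 14 * κ * (S : ℝ) := fun S hS ↦ by
    have : (1 : ℝ) ≤ S := by exact_mod_cast (Nat.one_le_pow _ _ hN1).trans hS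
    nlinarith
  have hT1 : ∀ S : ℕ, N ^ 2 ≤ S → 1 ≤ T S := fun S hS ↦ one_le_pow₀ (hbase S hS)
  have hpowT : ∀ (S : ℕ) (x : ℝ) (e : ℕ), N ^ 2 ≤ S → 0 ≤ x → x ≤ 14 * κ * S → e ≤ N * S →
      x ^ e ≤ T S := fun S x e hS hx hxle he ↦
    (pow_le_pow_left₀ hx hxle e).trans (pow_le_pow_right₀ (hbase S hS) he)
  have hκT : ∀ (S j : ℕ), N ^ 2 ≤ S → κ ^ (j * (N * S)) ≤ T S ^ j := fun S j hS ↦ by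
    rw [mul_comm j, pow_mul]
    refine pow_le_pow_left₀ (by positivity) (hpowT S κ _ hS hκ0 ?_ le_rfl) j
    have : (1 : ℝ) ≤ S := by exact_mod_cast (Nat.one_le_pow _ _ hN1).trans hS
    nlinarith
  have hNS : ∀ S : ℕ, N ^ 2 ≤ S → A ≤ N * S := fun S hS ↦ by
    rw [hA, pow_succ']
    exact Nat.mul_le_mul_left N hS
  have hS1 : ∀ S : ℕ, N ^ 2 ≤ S → 1 ≤ S := fun S hS ↦ (Nat.one_le_pow _ _ hN1).trans hS
  have hABT : ∀ S : ℕ, N ^ 2 ≤ S → ((A * B : ℕ) : ℝ) ≤ T S ^ 2 := fun S hS ↦ by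
    have h1 : A * B ≤ 2 * S ^ 2 := by
      rw [hAB]
      have := Nat.pow_le_pow_left hS 2
      rw [← pow_mul] at this
      norm_num at this
      omega
    have h1' : ((A * B : ℕ) : ℝ) ≤ 2 * (S : ℝ) ^ 2 := by exact_mod_cast h1
    have hS' : (1 : ℝ) ≤ S := by exact_mod_cast hS1 S hS
    have h2 : 14 * κ * (S : ℝ) ≤ T S :=
      le_self_pow₀ (hbase S hS) (Nat.mul_pos hN1 (hS1 S hS)).ne'
    have h3 : 14 * (S : ℝ) ≤ 14 * κ * (S : ℝ) := by nlinarith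
    have h4 : (14 * (S : ℝ)) ^ 2 ≤ T S ^ 2 := pow_le_pow_left₀ (by positivity) (h3.trans h2) 2
    nlinarith
  have hlattice : ∀ S : ℕ, N ^ 2 ≤ S → (2 * (S : ℝ)) ^ A * κ ^ (2 * B * S) ≤ T S ^ 5 := fun S hS ↦ by
    have e : 2 * B * S = 4 * (N * S) := by rw [hB]; ring
    have hS' : (1 : ℝ) ≤ S := by exact_mod_cast hS1 S hS
    rw [e, show T S ^ 5 = T S * T S ^ 4 by ring]
    refine mul_le_mul (hpowT S _ _ hS (by positivity) (by nlinarith) (hNS S hS)) (hκT S 4 hS)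
      (by positivity) (zero_le_one.trans (hT1 S hS))
  -- Siegel's lemma for the conditions at the lattice points `m + n i`, `0 ≤ m, n < N ^ 2`.
  obtain ⟨ξ, hξ0, hξmul, hξb⟩ := hsiegel (Fin (N ^ 2) × Fin (N ^ 2)) (Fin A × Fin B)
    (fun k l ↦ latticeValue u v J d (2 * B * N ^ 2) k.1 k.2 l.1 l.2)
    ((2 * (N ^ 2 : ℕ)) ^ A * κ ^ (2 * B * N ^ 2))
    (by simp only [Fintype.card_prod, Fintype.card_fin]; positivity)
    (by simp only [Fintype.card_prod, Fintype.card_fin]; rw [hAB]; ring)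
    (by
      have : (1 : ℝ) ≤ (N ^ 2 : ℕ) := by exact_mod_cast Nat.one_le_pow _ _ hN1
      exact one_le_mul_of_one_le_of_one_le (one_le_pow₀ (by linarith)) (one_le_pow₀ hκ1))
    (fun k l τ ↦ norm_map_latticeValue_le hJ2 (hκu' τ) (hκv' τ) hκd (by
        have h1 : (l.2 : ℕ) * k.1 ≤ B * N ^ 2 := Nat.mul_le_mul l.2.2.le k.1.2.le
        have h2 : (l.2 : ℕ) * k.2 ≤ B * N ^ 2 := Nat.mul_le_mul l.2.2.le k.2.2.le
        linarith) k.1.2.le k.2.2.le (Nat.one_le_pow _ _ hN1) l.1.2.le)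
  set F : ℂ → ℂ := expPoly lam fun l ↦ σ (ξ l) with hF
  have hFd : Differentiable ℂ F := differentiable_expPoly _ _
  have hξT : ∀ S : ℕ, N ^ 2 ≤ S → ∀ l, ∀ τ : K →+* ℂ, ‖τ (ξ l)‖ ≤ T S ^ 9 := by
    intro S hS l τ
    refine (hξb l τ).trans ?_
    rw [Fintype.card_prod, Fintype.card_fin, Fintype.card_fin]
    have h1 : C ^ 2 ≤ T S ^ 2 := by
      refine pow_le_pow_left₀ (by linarith) (hκC.trans ?_) 2
      have := hpowT S κ 1 hS hκ0
        (by have : (1 : ℝ) ≤ S := by exact_mod_cast hS1 S hS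
            nlinarith) (Nat.mul_pos hN1 (hS1 S hS))
      rwa [pow_one] at this
    have h2 : (2 * ((N ^ 2 : ℕ) : ℝ)) ^ A * κ ^ (2 * B * N ^ 2) ≤ T S ^ 5 := by
      refine le_trans ?_ (hlattice S hS)
      have : ((N ^ 2 : ℕ) : ℝ) ≤ S := by exact_mod_cast hS
      gcongr
    calc C ^ 2 * ((A * B : ℕ) : ℝ) * ((2 * ((N ^ 2 : ℕ) : ℝ)) ^ A * κ ^ (2 * B * N ^ 2))
        ≤ T S ^ 2 * T S ^ 2 * T S ^ 5 := by
          have := hABT S hS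
          gcongr
      _ = T S ^ 9 := by ring
  have hFT : ∀ S : ℕ, N ^ 2 ≤ S → ∀ w, ‖w‖ ≤ 14 * S → ‖F w‖ ≤ T S ^ 40 := by
    intro S hS w hw
    have hS' : (1 : ℝ) ≤ S := by exact_mod_cast hS1 S hS
    have hT0 : 0 ≤ T S := zero_le_one.trans (hT1 S hS)
    refine (norm_expPoly_le (fun l ↦ hξT S hS l σ) (by linarith) hw).trans ?_
    have h1 : (14 * (S : ℝ)) ^ A ≤ T S :=
      hpowT S _ _ hS (by positivity) (by nlinarith) (hNS S hS)
    have h2 : Real.exp (B * ‖lam‖ * (14 * S)) ≤ T S ^ 28 := by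
      have e : (B : ℝ) * ‖lam‖ * (14 * S) = (28 * (N * S) : ℕ) * ‖lam‖ := by
        rw [hB]; push_cast; ring
      rw [e, Real.exp_nat_mul]
      exact (pow_le_pow_left₀ (Real.exp_pos _).le hκl _).trans (hκT S 28 hS)
    calc ((A * B : ℕ) : ℝ) * (T S ^ 9 * ((14 * S) ^ A * Real.exp (B * ‖lam‖ * (14 * S))))
        ≤ T S ^ 2 * (T S ^ 9 * (T S * T S ^ 28)) := by
          have := hABT S hS
          gcongr
      _ = T S ^ 40 := by ring
  -- The algebraic integer `d ^ D F(m + n i)`.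
  have hval : ∀ (D m n : ℕ), (∀ c : Fin B, (c : ℕ) * m + c * n ≤ D) →
      σ (∑ l, latticeValue u v J d D m n l.1 l.2 * ξ l : 𝓞 K) =
        d ^ D * F ((m : ℂ) + n * Complex.I) := by
    intro D m n hD
    rw [hF, expPoly, mul_sum]
    simp only [map_sum, map_mul]
    refine sum_congr rfl fun l _ ↦ ?_
    rw [map_latticeValue hJ hu hv (hD l.2)]
    ring
  have hd0 : (d : ℂ) ≠ 0 := by exact_mod_cast hd.ne'
  have hzero : ∀ S : ℕ, N ^ 2 ≤ S →
      ∀ m < S, ∀ n < S, F ((m : ℂ) + n * Complex.I) = 0 := by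
    intro S hS
    induction S, hS using Nat.le_induction with
    | base =>
      intro m hm n hn
      have h1 := congrFun hξmul (⟨m, hm⟩, ⟨n, hn⟩)
      have h2 := hval (2 * B * N ^ 2) m n fun c ↦ by
        have h1 : (c : ℕ) * m ≤ B * N ^ 2 := Nat.mul_le_mul c.2.le hm.le
        have h2 : (c : ℕ) * n ≤ B * N ^ 2 := Nat.mul_le_mul c.2.le hn.le
        linarith
      simp only [Matrix.mulVec, dotProduct, Pi.zero_apply] at h1
      rw [h1] at h2
      simp only [map_zero] at h2
      exact (mul_eq_zero.1 h2.symm).resolve_left (pow_ne_zero _ hd0)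
    | succ S hS ih =>
      intro m hm n hn
      have hmS : m ≤ S := by omega
      have hnS : n ≤ S := by omega
      have hT0 : 0 ≤ T S := zero_le_one.trans (hT1 S hS)
      have hD : ∀ c : Fin B, (c : ℕ) * m + c * n ≤ 2 * B * S := fun c ↦ by
        have h1 : (c : ℕ) * m ≤ B * S := Nat.mul_le_mul c.2.le hmS
        have h2 : (c : ℕ) * n ≤ B * S := Nat.mul_le_mul c.2.le hnS
        linarith
      have hsmall := hFd.norm_le_of_latticeSquare (hS1 S hS) ih (hFT S hS)
        (norm_latticePoint_le hmS hnS)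
      by_contra hne
      set η : 𝓞 K := ∑ l, latticeValue u v J d (2 * B * S) m n l.1 l.2 * ξ l with hη
      have hση : σ η = d ^ (2 * B * S) * F ((m : ℂ) + n * Complex.I) := hval _ m n hD
      have hη0 : η ≠ 0 := by
        intro h0
        rw [h0] at hση
        simp only [map_zero] at hση
        exact mul_ne_zero (pow_ne_zero _ hd0) hne hση.symm
      have hηT : ∀ τ : K →+* ℂ, ‖τ η‖ ≤ T S ^ 16 := by
        intro τ
        rw [hη]
        simp only [map_sum, map_mul]
        refine (norm_sum_le_of_le _ (n := fun _ ↦ T S ^ 14) fun l _ ↦ ?_).trans ?_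
        · rw [norm_mul, show T S ^ 14 = T S ^ 5 * T S ^ 9 by ring]
          refine mul_le_mul ((norm_map_latticeValue_le hJ2 (hκu' τ) (hκv' τ) hκd (hD l.2) hmS hnS
            (hS1 S hS) l.1.2.le).trans (hlattice S hS)) (hξT S hS l τ) (norm_nonneg _)
            (by positivity)
        · rw [sum_const, card_univ, Fintype.card_prod, Fintype.card_fin, Fintype.card_fin,
            nsmul_eq_mul, show T S ^ 16 = T S ^ 2 * T S ^ 14 by ring]
          exact mul_le_mul_of_nonneg_right (hABT S hS) (by positivity)
      have hlow := NumberField.one_le_norm_mul_pow hη0 hηT σ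
      have hdT : (d : ℝ) ^ (2 * B * S) ≤ T S ^ 4 := by
        have e : 2 * B * S = 4 * (N * S) := by rw [hB]; ring
        rw [e]
        exact (pow_le_pow_left₀ (Nat.cast_nonneg d) hκd _).trans (hκT S 4 hS)
      have h3 : (0 : ℝ) < 3 ^ (S * S) := by positivity
      have hup : ‖σ η‖ * (T S ^ 16) ^ h ≤ T S ^ (44 + 16 * h) / 3 ^ (S * S) := by
        rw [hση, norm_mul, norm_pow, Complex.norm_natCast]
        calc (d : ℝ) ^ (2 * B * S) * ‖F ((m : ℂ) + n * Complex.I)‖ * (T S ^ 16) ^ h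
            ≤ T S ^ 4 * (T S ^ 40 / 3 ^ (S * S)) * (T S ^ 16) ^ h := by gcongr
          _ = T S ^ (44 + 16 * h) / 3 ^ (S * S) := by rw [pow_add, pow_mul]; ring
      have h4 := hS₀ S (by nlinarith [hS]) N hS
      have h5 : (1 : ℝ) ≤ S := by exact_mod_cast hS1 S hS
      have h6 : T S ^ (44 + 16 * h) ≤ T S ^ (44 + 16 * h) * S :=
        le_mul_of_one_le_right (by positivity) h5
      have h7 := hlow.trans hup
      rw [le_div_iff₀ h3, one_mul] at h7
      exact absurd (h7.trans h6) (not_le.2 h4)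
  -- `F` has too many zeros for its growth.
  have hFzero : ∀ z, F z = 0 := by
    intro z
    by_contra hne
    obtain ⟨S₁, hS₁⟩ := exists_nat_gt (1 / ‖F z‖)
    obtain ⟨S₂, hS₂⟩ := exists_nat_ge ‖z‖
    set S := N ^ 2 + S₁ + S₂ with hSdef
    have hS : N ^ 2 ≤ S := by omega
    have hzS : ‖z‖ ≤ 2 * S := by
      have : (S₂ : ℝ) ≤ S := by exact_mod_cast (by omega : S₂ ≤ S)
      have : (0 : ℝ) ≤ S := Nat.cast_nonneg _
      linarith
    have h1 := hFd.norm_le_of_latticeSquare (hS1 S hS) (hzero S hS) (hFT S hS) hzS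
    have h2 := hS₀ S (by nlinarith [hS]) N hS
    have h3 : T S ^ 40 ≤ T S ^ (44 + 16 * h) := pow_le_pow_right₀ (hT1 S hS) (by omega)
    have hSpos : (0 : ℝ) < S := by exact_mod_cast hS1 S hS
    have h4 : T S ^ 40 * S < 3 ^ (S * S) := (mul_le_mul_of_nonneg_right h3 hSpos.le).trans_lt h2
    have h5 : T S ^ 40 / 3 ^ (S * S) < 1 / S := by
      rw [div_lt_div_iff₀ (by positivity) hSpos, one_mul]
      exact h4
    have h6 : (S₁ : ℝ) ≤ S := by exact_mod_cast (by omega : S₁ ≤ S)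
    have h7 : 1 / (S : ℝ) < ‖F z‖ := by
      rw [one_div_lt hSpos (norm_pos_iff.2 hne)]
      linarith
    linarith
  refine hξ0 (funext fun l ↦ ?_)
  have h1 := congrFun (eq_zero_of_expPoly_eq_zero hlam hFzero) l
  refine RingOfIntegers.ext (σ.injective ?_)
  simpa using h1

/-- **Gelfond–Schneider for the exponent `i`**: if `lam ≠ 0`, then `exp lam` and `exp (lam i)` are
not both algebraic. -/
theorem Complex.not_isAlgebraic_exp_mul_I {lam : ℂ} (hlam : lam ≠ 0)
    (h1 : IsAlgebraic ℚ (Complex.exp lam)) : ¬ IsAlgebraic ℚ (Complex.exp (lam * Complex.I)) := by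
  intro h2
  have hI : IsIntegral ℤ Complex.I :=
    ⟨Polynomial.X ^ 2 + 1, by monicity!, by simp⟩
  set s : Set ℂ := {Complex.I, Complex.exp lam, Complex.exp (lam * Complex.I)} with hs
  have hint : ∀ x ∈ s, IsIntegral ℚ x := by
    rintro x (rfl | rfl | rfl)
    · exact hI.tower_top
    · exact h1.isIntegral
    · exact h2.isIntegral
  let K := IntermediateField.adjoin ℚ s
  have hfin : FiniteDimensional ℚ K := by
    have : Finite s := by rw [hs]; exact Set.Finite.to_subtype (Set.toFinite _)
    exact IntermediateField.finiteDimensional_adjoin hint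
  have : NumberField K := ⟨⟩
  have hmem : ∀ x ∈ s, x ∈ K := fun x hx ↦ IntermediateField.subset_adjoin ℚ s hx
  have hmult : ∀ x : ℂ, IsAlgebraic ℚ x → ∃ d : ℕ, 0 < d ∧ IsIntegral ℤ (d * x) := by
    intro x hx
    obtain ⟨y, hy, hyx⟩ := ((IsFractionRing.isAlgebraic_iff ℤ ℚ ℂ).2 hx).exists_integral_multiple
    refine ⟨y.natAbs, Int.natAbs_pos.2 hy, ?_⟩
    rcases Int.natAbs_eq y with h | h
    · rw [h] at hyx
      simpa using hyx
    · rw [h] at hyx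
      simpa using hyx.neg
  obtain ⟨d₁, hd₁, hi₁⟩ := hmult _ h1
  obtain ⟨d₂, hd₂, hi₂⟩ := hmult _ h2
  have hnat : ∀ n : ℕ, IsIntegral ℤ (n : ℂ) := fun n ↦ by
    simpa using isIntegral_algebraMap (R := ℤ) (A := ℂ) (x := (n : ℤ))
  have hmk : ∀ x : K, IsIntegral ℤ (x : ℂ) → ∃ y : 𝓞 K, (y : K) = x := fun x hx ↦ by
    have : IsIntegral ℤ x := (isIntegral_algHom_iff (K.val.restrictScalars ℤ)
      (Subtype.val_injective)).1 hx
    exact ⟨⟨x, this⟩, rfl⟩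
  obtain ⟨J, hJ⟩ := hmk ⟨Complex.I, hmem _ (by simp [hs])⟩ hI
  let x : K := ⟨Complex.exp lam, hmem _ (by simp [hs])⟩
  let y : K := ⟨Complex.exp (lam * Complex.I), hmem _ (by simp [hs])⟩
  have hx : (((d₁ * d₂ : ℕ) * x : K) : ℂ) = d₂ * (d₁ * Complex.exp lam) := by
    push_cast
    simp only [x]
    ring
  have hy : (((d₁ * d₂ : ℕ) * y : K) : ℂ) = d₁ * (d₂ * Complex.exp (lam * Complex.I)) := by
    push_cast
    simp only [y]
    ring
  obtain ⟨u, hu⟩ := hmk ((d₁ * d₂ : ℕ) * x) (by rw [hx]; exact (hnat d₂).mul hi₁)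
  obtain ⟨v, hv⟩ := hmk ((d₁ * d₂ : ℕ) * y) (by rw [hy]; exact (hnat d₁).mul hi₂)
  refine NumberField.false_of_map_eq_exp (K := K) (σ := (algebraMap K ℂ)) (u := u) (v := v) (J := J)
    (d := d₁ * d₂) hlam ?_ ?_ ?_ (Nat.mul_pos hd₁ hd₂)
  · rw [hJ]; rfl
  · rw [hu, map_mul, map_natCast]; rfl
  · rw [hv, map_mul, map_natCast]; rfl

end

/-! ### The generators from Gaussian primes -/

section

open Finset Filter

theorem Complex.isAlgebraic_I : IsAlgebraic ℚ Complex.I :=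
  IsAlgebraic.of_pow two_pos (by rw [Complex.I_sq]; exact isAlgebraic_one.neg)

theorem Complex.exp_arg_add_mul_I (z : ℂ) (k : ℤ) :
    ‖z‖ * Complex.exp ((z.arg + 2 * k * Real.pi : ℝ) * Complex.I) = z := by
  have e : ((z.arg + 2 * k * Real.pi : ℝ) : ℂ) * Complex.I =
      z.arg * Complex.I + k * (2 * Real.pi * Complex.I) := by
    push_cast; ring
  rw [e, Complex.exp_add, Complex.exp_int_mul_two_pi_mul_I, mul_one,
    Complex.norm_mul_exp_arg_mul_I]

/-- If `f ≠ 0` is a value of the argument of `b + a i`, then `exp f` is transcendental, because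
`exp (f i) = (b + a i) / |b + a i|` is algebraic. -/
theorem transcendental_exp_of_arg {a b : ℕ} (hb : 0 < b) {f : ℝ} (hf0 : f ≠ 0)
    (hf : ‖(b : ℂ) + a * Complex.I‖ * Complex.exp (f * Complex.I) = b + a * Complex.I) :
    Transcendental ℚ (Real.exp f) := by
  intro halg
  have h1 : IsAlgebraic ℚ (Complex.exp (f : ℂ)) := by
    rw [← Complex.ofReal_exp]
    exact halg.algebraMap (A := ℂ)
  refine Complex.not_isAlgebraic_exp_mul_I (Complex.ofReal_ne_zero.2 hf0) h1 ?_
  have hnat : ∀ n : ℕ, IsAlgebraic ℚ (n : ℂ) := fun n ↦ isAlgebraic_natCast n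
  have hz : IsAlgebraic ℚ ((b : ℂ) + a * Complex.I) :=
    (hnat b).add ((hnat a).mul Complex.isAlgebraic_I)
  have hnorm : IsAlgebraic ℚ ((‖(b : ℂ) + a * Complex.I‖ : ℝ) : ℂ) := by
    refine IsAlgebraic.of_pow two_pos ?_
    have e : ((‖(b : ℂ) + a * Complex.I‖ : ℝ) : ℂ) ^ 2 = ((b ^ 2 + a ^ 2 : ℕ) : ℂ) := by
      rw [← Complex.ofReal_pow, Complex.sq_norm, Complex.normSq_apply]
      simp
      ring
    rw [e]
    exact hnat _
  have hne : ((‖(b : ℂ) + a * Complex.I‖ : ℝ) : ℂ) ≠ 0 := by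
    rw [Complex.ofReal_ne_zero, norm_ne_zero_iff]
    intro h
    have := congrArg Complex.re h
    simp at this
    omega
  rw [eq_div_of_mul_eq hne ((mul_comm _ _).trans hf), div_eq_mul_inv]
  exact hz.mul hnorm.inv

theorem exists_sq_add_sq_of_mod_four_eq_one {p : ℕ} (hp : p.Prime) (h4 : p % 4 = 1) :
    ∃ a b : ℕ, 0 < a ∧ a < b ∧ p = a ^ 2 + b ^ 2 := by
  have : Fact p.Prime := ⟨hp⟩
  obtain ⟨a, b, hab⟩ := Nat.Prime.sq_add_sq (p := p) (by omega)
  have hsq : ∀ n : ℕ, n ^ 2 ≠ p := fun n h ↦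
    hp.prime.not_isSquare ⟨n, by rw [← sq]; exact h.symm⟩
  have ha : 0 < a := Nat.pos_of_ne_zero fun h ↦ hsq b (by rw [h] at hab; simpa using hab)
  have hb : 0 < b := Nat.pos_of_ne_zero fun h ↦ hsq a (by rw [h] at hab; simpa using hab)
  rcases lt_trichotomy a b with h | h | h
  · exact ⟨a, b, ha, h, hab.symm⟩
  · subst h; omega
  · exact ⟨b, a, hb, h, by rw [← hab, add_comm]⟩

/-- Uniqueness of the representation of a prime as a sum of two squares: `p` divides
`(ad - bc)(ad + bc) = p (a² - c²)`, and both factors are smaller than `p` in absolute value. -/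
theorem sq_add_sq_unique {p a b c d : ℕ} (hp : p.Prime) (ha : 0 < a) (hab : a < b)
    (h₁ : p = a ^ 2 + b ^ 2) (hc : 0 < c) (hcd : c < d) (h₂ : p = c ^ 2 + d ^ 2) :
    a = c ∧ b = d := by
  have h₁' : (p : ℤ) = a ^ 2 + b ^ 2 := by exact_mod_cast h₁
  have h₂' : (p : ℤ) = c ^ 2 + d ^ 2 := by exact_mod_cast h₂
  zify at ha hab hc hcd
  have hp0 : (0 : ℤ) < p := by exact_mod_cast hp.pos
  have hdvd : (p : ℤ) ∣ ((a : ℤ) * d - b * c) * (a * d + b * c) :=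
    ⟨a ^ 2 - c ^ 2, by linear_combination (-(a : ℤ) ^ 2) * h₂' + (c : ℤ) ^ 2 * h₁'⟩
  have hsum : ((a : ℤ) * d + b * c) ^ 2 + (b * d - a * c) ^ 2 = (p : ℤ) ^ 2 := by
    rw [sq (p : ℤ)]; nth_rw 1 [h₁']; rw [h₂']; ring
  have hdiff : ((a : ℤ) * d - b * c) ^ 2 + (b * d + a * c) ^ 2 = (p : ℤ) ^ 2 := by
    rw [sq (p : ℤ)]; nth_rw 1 [h₁']; rw [h₂']; ring
  have hpos : 0 < (a : ℤ) * d + b * c := by nlinarith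
  have hlt : (a : ℤ) * c < b * d := by nlinarith
  have h3 : (a : ℤ) * d + b * c < p := by nlinarith
  have h4 : ¬ (p : ℤ) ∣ (a : ℤ) * d + b * c := fun h ↦ absurd (Int.le_of_dvd hpos h) (not_le.2 h3)
  have h5 : (p : ℤ) ∣ (a : ℤ) * d - b * c :=
    ((Nat.prime_iff_prime_int.1 hp).dvd_or_dvd hdvd).resolve_right h4
  have h6 : |(a : ℤ) * d - b * c| < p := by
    refine abs_lt_of_sq_lt_sq ?_ hp0.le
    have : 0 < (b : ℤ) * d + a * c := by nlinarith
    nlinarith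
  have h7 : (a : ℤ) * d - b * c = 0 := Int.eq_zero_of_abs_lt_dvd h5 h6
  have h8 : (p : ℤ) * (a ^ 2 - c ^ 2) = 0 := by
    linear_combination ((a : ℤ) * d + b * c) * h7 + (a : ℤ) ^ 2 * h₂' - (c : ℤ) ^ 2 * h₁'
  have h9 : (a : ℤ) ^ 2 = c ^ 2 :=
    sub_eq_zero.1 ((mul_eq_zero.1 h8).resolve_left hp0.ne')
  have h10 : a ^ 2 = c ^ 2 := by exact_mod_cast h9
  have h11 : a = c := Nat.pow_left_injective two_ne_zero h10
  have h12 : b ^ 2 = d ^ 2 := by omega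
  exact ⟨h11, Nat.pow_left_injective two_ne_zero h12⟩

/-- The argument of `b + a i` has a value in the open window `(log p, log p + 2π)`. It has exactly one
in the half-open window, and this cannot be the endpoint: otherwise `log p` would be a value of the
argument, although `exp (log p) = p` is algebraic. -/
theorem exists_arg_between {p a b : ℕ} (hp : p.Prime) (hb : 0 < b) :
    ∃ k : ℤ, Real.log p < Complex.arg ((b : ℂ) + a * Complex.I) + 2 * k * Real.pi ∧
      Complex.arg ((b : ℂ) + a * Complex.I) + 2 * k * Real.pi < Real.log p + 2 * Real.pi := by
  set z : ℂ := (b : ℂ) + a * Complex.I with hz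
  obtain ⟨k, ⟨hk1, hk2⟩, -⟩ := existsUnique_add_zsmul_mem_Ioc Real.two_pi_pos z.arg (Real.log p)
  rw [zsmul_eq_mul] at hk1 hk2
  have e : (k : ℝ) * (2 * Real.pi) = 2 * k * Real.pi := by ring
  rw [e] at hk1 hk2
  refine ⟨k, hk1, lt_of_le_of_ne hk2 fun heq ↦ ?_⟩
  have hp1 : (1 : ℝ) < p := by exact_mod_cast hp.one_lt
  have hlog : Real.log p = z.arg + 2 * (k - 1 : ℤ) * Real.pi := by
    push_cast; linarith
  refine transcendental_exp_of_arg hb (a := a) (f := Real.log p) (Real.log_pos hp1).ne' ?_ ?_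
  · rw [hlog]
    exact Complex.exp_arg_add_mul_I z (k - 1)
  · rw [Real.exp_log (by linarith)]
    exact isAlgebraic_natCast p

theorem gaussianGenerators_transcendental : ∀ g ∈ gaussianGenerators, Transcendental ℚ g := by
  rintro _ ⟨p, a, b, k, f, hp, -, -, -, hab, hf, hlog, -, rfl⟩
  have hf0 : 0 < f := (Real.log_nonneg (by exact_mod_cast hp.one_le)).trans_lt hlog
  refine transcendental_exp_of_arg (a := a) (b := b) (by omega) hf0.ne' ?_
  rw [hf]
  exact Complex.exp_arg_add_mul_I _ k

theorem GaussianInt.prime_of_prime_norm {u : GaussianInt} (hu : u.norm.natAbs.Prime) :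
    Prime u := by
  rw [← irreducible_iff_prime]
  refine ⟨fun h ↦ ?_, fun {x y} hxy ↦ ?_⟩
  · rw [← Zsqrtd.norm_eq_one_iff] at h
    exact hu.one_lt.ne' h
  · rw [hxy, Zsqrtd.norm_mul, Int.natAbs_mul, Nat.prime_mul_iff] at hu
    rw [← Zsqrtd.norm_eq_one_iff, ← Zsqrtd.norm_eq_one_iff]
    rcases hu with h | h
    · exact Or.inr h.2
    · exact Or.inl h.2

theorem GaussianInt.natAbs_norm_dvd {u v : GaussianInt} (h : u ∣ v) :
    u.norm.natAbs ∣ v.norm.natAbs := by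
  obtain ⟨w, rfl⟩ := h
  rw [Zsqrtd.norm_mul, Int.natAbs_mul]
  exact dvd_mul_right _ _

/-- For an odd prime `p = a² + b²` the Gaussian primes `b + a i` and `b - a i` are not associated:
otherwise `b + a i` would divide their sum `2b`. -/
theorem GaussianInt.not_dvd_star {p a b : ℕ} (hp : p.Prime) (h4 : p % 4 = 1) (ha : 0 < a)
    (hb : 0 < b) (hpab : p = a ^ 2 + b ^ 2) :
    ¬ (⟨b, a⟩ : GaussianInt) ∣ star (⟨b, a⟩ : GaussianInt) := by
  intro h
  have h1 : (⟨b, a⟩ : GaussianInt) ∣ ((2 * b : ℕ) : GaussianInt) := by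
    have h2 := dvd_add (dvd_refl (⟨b, a⟩ : GaussianInt)) h
    convert h2 using 1
    ext
    · simp; ring
    · simp
  have h2 := GaussianInt.natAbs_norm_dvd h1
  have e : (⟨b, a⟩ : GaussianInt).norm.natAbs = p := by
    have : (⟨b, a⟩ : GaussianInt).norm = (p : ℤ) := by
      rw [Zsqrtd.norm_def, hpab]; push_cast; ring
    rw [this, Int.natAbs_natCast]
  rw [e, Zsqrtd.norm_natCast, Int.natAbs_mul, Int.natAbs_natCast] at h2
  have h3 : p ∣ 2 * b := ((Nat.Prime.dvd_mul hp).1 h2).elim id id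
  rcases (Nat.Prime.dvd_mul hp).1 h3 with h | h
  · have := Nat.le_of_dvd two_pos h
    have := hp.two_le
    omega
  · have := Nat.le_of_dvd hb h
    nlinarith

/-- Two Gaussian integers with non-real quotient and arguments `Φ₁`, `Φ₂` (as real numbers) satisfy
`1 ≤ |Im (z₁ conj z₂)| ≤ |z₁| |z₂| |Φ₁ - Φ₂|`, and `exp` spreads this out to distance `1`. -/
theorem GaussianInt.one_le_abs_exp_sub_exp {z₁ z₂ : GaussianInt} {Φ₁ Φ₂ : ℝ}
    (h₁ : ‖(z₁ : ℂ)‖ * Complex.exp (Φ₁ * Complex.I) = z₁)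
    (h₂ : ‖(z₂ : ℂ)‖ * Complex.exp (Φ₂ * Complex.I) = z₂)
    (hn₁ : (z₁.norm : ℝ) ≤ Real.exp Φ₁) (hn₂ : (z₂.norm : ℝ) ≤ Real.exp Φ₂)
    (him : (z₁ * star z₂).im ≠ 0) : 1 ≤ |Real.exp Φ₁ - Real.exp Φ₂| := by
  have hexp : ∀ {x y : ℝ}, y ≤ x →
      Real.exp (x / 2) * Real.exp (y / 2) * (x - y) ≤ Real.exp x - Real.exp y := by
    intro x y hxy
    have h := Real.self_le_sinh_iff.2 (show 0 ≤ (x - y) / 2 by linarith)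
    rw [Real.sinh_eq] at h
    have e1 : Real.exp x = Real.exp (x / 2) * Real.exp (y / 2) * Real.exp ((x - y) / 2) := by
      rw [← Real.exp_add, ← Real.exp_add]; ring_nf
    have e2 : Real.exp y = Real.exp (x / 2) * Real.exp (y / 2) * Real.exp (-((x - y) / 2)) := by
      rw [← Real.exp_add, ← Real.exp_add]; ring_nf
    rw [e1, e2, ← mul_sub]
    refine mul_le_mul_of_nonneg_left (by linarith) (by positivity)
  have habs : Real.exp (Φ₁ / 2) * Real.exp (Φ₂ / 2) * |Φ₁ - Φ₂| ≤ |Real.exp Φ₁ - Real.exp Φ₂| := by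
    rcases le_total Φ₂ Φ₁ with h | h
    · rw [abs_of_nonneg (sub_nonneg.2 h)]
      exact (hexp h).trans (le_abs_self _)
    · rw [abs_sub_comm, abs_of_nonneg (sub_nonneg.2 h), abs_sub_comm, mul_comm (Real.exp _)]
      exact (hexp h).trans (le_abs_self _)
  have hroot : ∀ {z : GaussianInt} {Φ : ℝ}, (z.norm : ℝ) ≤ Real.exp Φ →
      ‖(z : ℂ)‖ ≤ Real.exp (Φ / 2) := by
    intro z Φ h
    refine le_of_sq_le_sq ?_ (Real.exp_pos _).le
    rw [Complex.sq_norm, ← GaussianInt.intCast_real_norm, ← Real.exp_nat_mul]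
    refine h.trans_eq ?_
    congr 1
    push_cast; ring
  have hIm : ((z₁ * star z₂).im : ℝ) = ‖(z₁ : ℂ)‖ * ‖(z₂ : ℂ)‖ * Real.sin (Φ₁ - Φ₂) := by
    rw [GaussianInt.intCast_im, GaussianInt.toComplex_mul, GaussianInt.toComplex_star]
    nth_rw 1 [← h₁, ← h₂]
    rw [map_mul, ← Complex.exp_conj, map_mul, Complex.conj_ofReal, Complex.conj_ofReal,
      Complex.conj_I]
    have e : (‖(z₁ : ℂ)‖ : ℂ) * Complex.exp (Φ₁ * Complex.I) *
        (‖(z₂ : ℂ)‖ * Complex.exp (Φ₂ * -Complex.I)) =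
        ((‖(z₁ : ℂ)‖ * ‖(z₂ : ℂ)‖ : ℝ) : ℂ) * Complex.exp ((Φ₁ - Φ₂ : ℝ) * Complex.I) := by
      have : ((Φ₁ - Φ₂ : ℝ) : ℂ) * Complex.I = Φ₁ * Complex.I + Φ₂ * -Complex.I := by
        push_cast; ring
      rw [this, Complex.exp_add]
      push_cast
      ring
    rw [e, Complex.im_ofReal_mul, Complex.exp_ofReal_mul_I_im]
  have h1 : (1 : ℝ) ≤ |((z₁ * star z₂).im : ℝ)| := by exact_mod_cast Int.one_le_abs him
  rw [hIm, abs_mul, abs_of_nonneg (by positivity)] at h1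
  calc (1 : ℝ) ≤ ‖(z₁ : ℂ)‖ * ‖(z₂ : ℂ)‖ * |Real.sin (Φ₁ - Φ₂)| := h1
    _ ≤ Real.exp (Φ₁ / 2) * Real.exp (Φ₂ / 2) * |Φ₁ - Φ₂| := by
        have := hroot hn₁
        have := hroot hn₂
        have := Real.abs_sin_le_abs (x := Φ₁ - Φ₂)
        gcongr
    _ ≤ _ := habs

/-- Exponents in a product of Gaussian primes, no two of which are associated or conjugate, are
determined by the argument of the product modulo `π`: compare the multiplicities of each prime on
both sides of `z conj w = conj z w`. -/
theorem GaussianInt.finsupp_eq_of_im_eq_zero {ι : Type*} {u : ι → GaussianInt}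
    (hu : ∀ i, Prime (u i)) (hne : ∀ i j, i ≠ j → ¬ u i ∣ u j) (hstar : ∀ i j, ¬ u i ∣ star (u j))
    {k l : ι →₀ ℕ} (h : ((k.prod fun i n ↦ u i ^ n) * star (l.prod fun i n ↦ u i ^ n)).im = 0) :
    k = l := by
  have hmul : ∀ (k : ι →₀ ℕ) (i : ι), emultiplicity (u i) (k.prod fun i n ↦ u i ^ n) = k i := by
    intro k i
    rw [Finsupp.prod, Finset.emultiplicity_prod (hu i)]
    simp only [emultiplicity_pow (hu i)]
    have hself : emultiplicity (u i) (u i) = 1 :=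
      (FiniteMultiplicity.of_prime_left (hu i) (hu i).ne_zero).emultiplicity_self
    rw [sum_eq_single i, hself, mul_one]
    · intro j _ hji
      rw [emultiplicity_eq_zero.2 (hne i j hji.symm), mul_zero]
    · intro hi
      rw [Finsupp.notMem_support_iff.1 hi]
      simp
  have hmul_star : ∀ (k : ι →₀ ℕ) (i : ι),
      emultiplicity (u i) (star (k.prod fun i n ↦ u i ^ n)) = 0 := by
    intro k i
    rw [emultiplicity_eq_zero, Finsupp.prod, star_prod]
    intro hdvd
    obtain ⟨j, -, hj⟩ := (hu i).exists_mem_finset_dvd hdvd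
    rw [star_pow] at hj
    exact hstar i j ((hu i).dvd_of_dvd_pow hj)
  set Z := k.prod fun i n ↦ u i ^ n with hZ
  set W := l.prod fun i n ↦ u i ^ n with hW
  have hreal : Z * star W = star Z * W := by
    have h1 : star (Z * star W) = Z * star W := by
      ext
      · simp only [Zsqrtd.re_star]
      · rw [Zsqrtd.im_star, h, neg_zero]
    rw [← h1, star_mul', star_star]
  ext i
  have h2 := congrArg (emultiplicity (u i)) hreal
  rw [emultiplicity_mul (hu i), emultiplicity_mul (hu i), hmul, hmul_star, hmul_star, hmul,
    add_zero, zero_add] at h2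
  exact_mod_cast h2

theorem isDenseLacunary_gaussianGenerators : IsDenseLacunary gaussianGenerators := by
  have hex : ∀ p : {p : ℕ // p.Prime ∧ p % 4 = 1}, ∃ (a b : ℕ) (k : ℤ), 0 < a ∧ a < b ∧
      (p : ℕ) = a ^ 2 + b ^ 2 ∧
      Real.log p < Complex.arg ((b : ℂ) + a * Complex.I) + 2 * k * Real.pi ∧
      Complex.arg ((b : ℂ) + a * Complex.I) + 2 * k * Real.pi < Real.log p + 2 * Real.pi := by
    rintro ⟨p, hp, h4⟩
    obtain ⟨a, b, ha, hab, hpab⟩ := exists_sq_add_sq_of_mod_four_eq_one hp h4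
    obtain ⟨k, hk⟩ := exists_arg_between (a := a) (b := b) hp (by omega)
    exact ⟨a, b, k, ha, hab, hpab, hk⟩
  choose a b k ha hab hpab hlow hup using hex
  set f : {p : ℕ // p.Prime ∧ p % 4 = 1} → ℝ := fun p ↦
    Complex.arg ((b p : ℂ) + a p * Complex.I) + 2 * k p * Real.pi with hf
  have hp0 : ∀ p : {p : ℕ // p.Prime ∧ p % 4 = 1}, (0 : ℝ) < (p : ℕ) := fun p ↦ by
    exact_mod_cast p.2.1.pos
  have hrange : gaussianGenerators = Set.range fun p ↦ Real.exp (f p) := by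
    ext g
    constructor
    · rintro ⟨p, a', b', k', f', hp, h4, hp', ha', hab', hf', hlow', hup', rfl⟩
      refine ⟨⟨p, hp, h4⟩, ?_⟩
      obtain ⟨h1, h2⟩ := sq_add_sq_unique hp (ha ⟨p, hp, h4⟩) (hab ⟨p, hp, h4⟩)
        (hpab ⟨p, hp, h4⟩) ha' hab' hp'
      have hl := hlow ⟨p, hp, h4⟩
      have hu := hup ⟨p, hp, h4⟩
      simp only [hf]
      rw [h1, h2] at hl hu ⊢
      rw [hf'] at hlow' hup' ⊢
      have hpi := Real.pi_pos
      have hk1 : ((k ⟨p, hp, h4⟩ : ℤ) : ℝ) < k' + 1 := by nlinarith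
      have hk2 : (k' : ℝ) < k ⟨p, hp, h4⟩ + 1 := by nlinarith
      have hk1' : k ⟨p, hp, h4⟩ < k' + 1 := by exact_mod_cast hk1
      have hk2' : k' < k ⟨p, hp, h4⟩ + 1 := by exact_mod_cast hk2
      have : k ⟨p, hp, h4⟩ = k' := by omega
      rw [this]
    · rintro ⟨p, rfl⟩
      exact ⟨p, a p, b p, k p, f p, p.2.1, p.2.2, hpab p, ha p, hab p, rfl, hlow p, hup p, rfl⟩
  have hpexp : ∀ p : {p : ℕ // p.Prime ∧ p % 4 = 1}, ((p : ℕ) : ℝ) < Real.exp (f p) := fun p ↦ by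
    rw [← Real.log_lt_iff_lt_exp (hp0 p)]
    exact hlow p
  rw [hrange]
  refine isDenseLacunary_range (C := Real.exp (2 * Real.pi)) (fun p hp ↦ hp.1.pos) hpexp
    (fun p ↦ ?_) exists_le_card_primes_one_mod_four fun k l hkl ↦ ?_
  · calc Real.exp (f p) ≤ Real.exp (Real.log p + 2 * Real.pi) := Real.exp_le_exp.2 (hup p).le
      _ = Real.exp (2 * Real.pi) * (p : ℕ) := by rw [Real.exp_add, Real.exp_log (hp0 p), mul_comm]
  · set u : {p : ℕ // p.Prime ∧ p % 4 = 1} → GaussianInt := fun p ↦ ⟨b p, a p⟩ with hu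
    have hcoe : ∀ p, ((u p : GaussianInt) : ℂ) = b p + a p * Complex.I := fun p ↦ by
      rw [hu, GaussianInt.toComplex_def']; push_cast; rfl
    have hnorm : ∀ p, (u p).norm = ((p : ℕ) : ℤ) := fun p ↦ by
      rw [hpab p, hu, Zsqrtd.norm_def]; push_cast; ring
    have hnorm' : ∀ p, (u p).norm.natAbs = (p : ℕ) := fun p ↦ by
      rw [hnorm, Int.natAbs_natCast]
    have hprime : ∀ p, Prime (u p) := fun p ↦
      GaussianInt.prime_of_prime_norm (by rw [hnorm']; exact p.2.1)
    have hne : ∀ p q : {p : ℕ // p.Prime ∧ p % 4 = 1}, p ≠ q → ¬ (p : ℕ) ∣ (q : ℕ) := fun p q hpq h ↦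
      hpq (Subtype.ext ((Nat.prime_dvd_prime_iff_eq p.2.1 q.2.1).1 h))
    have hphase : ∀ m : {p : ℕ // p.Prime ∧ p % 4 = 1} →₀ ℕ,
        ‖((m.prod fun p n ↦ u p ^ n : GaussianInt) : ℂ)‖ *
          Complex.exp ((m.sum fun p n ↦ n * f p : ℝ) * Complex.I) =
        ((m.prod fun p n ↦ u p ^ n : GaussianInt) : ℂ) := by
      intro m
      have e : ((m.sum fun p n ↦ n * f p : ℝ) : ℂ) * Complex.I =
          ∑ p ∈ m.support, (m p : ℕ) * ((f p : ℂ) * Complex.I) := by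
        rw [Finsupp.sum, Complex.ofReal_sum, sum_mul]
        exact sum_congr rfl fun p _ ↦ by push_cast; ring
      rw [e, Complex.exp_sum]
      simp only [Complex.exp_nat_mul, Finsupp.prod, map_prod, map_pow, norm_prod, norm_pow]
      rw [Complex.ofReal_prod, ← prod_mul_distrib]
      refine prod_congr rfl fun p _ ↦ ?_
      rw [Complex.ofReal_pow, ← mul_pow, hcoe]
      congr 1
      exact Complex.exp_arg_add_mul_I _ _
    have hle : ∀ m : {p : ℕ // p.Prime ∧ p % 4 = 1} →₀ ℕ,
        (((m.prod fun p n ↦ u p ^ n).norm : ℤ) : ℝ) ≤ Real.exp (m.sum fun p n ↦ n * f p) := by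
      intro m
      have h1 : (m.prod fun p n ↦ u p ^ n).norm =
          Zsqrtd.normMonoidHom (m.prod fun p n ↦ u p ^ n) := rfl
      rw [h1]
      simp only [Finsupp.prod, Finsupp.sum, map_prod, map_pow, Real.exp_sum, Int.cast_prod,
        Int.cast_pow, Real.exp_nat_mul]
      refine prod_le_prod (fun p _ ↦ ?_) fun p _ ↦ ?_
      · have : Zsqrtd.normMonoidHom (u p) = ((p : ℕ) : ℤ) := hnorm p
        rw [this]; positivity
      · have : Zsqrtd.normMonoidHom (u p) = ((p : ℕ) : ℤ) := hnorm p
        rw [this, Int.cast_natCast]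
        exact pow_le_pow_left₀ (hp0 p).le (hpexp p).le _
    have hexp : ∀ m : {p : ℕ // p.Prime ∧ p % 4 = 1} →₀ ℕ,
        (m.prod fun p n ↦ Real.exp (f p) ^ n) = Real.exp (m.sum fun p n ↦ n * f p) := by
      intro m
      simp only [Finsupp.prod, Finsupp.sum, Real.exp_sum, Real.exp_nat_mul]
    rw [hexp, hexp]
    refine GaussianInt.one_le_abs_exp_sub_exp (hphase k) (hphase l) (hle k) (hle l) fun him ↦ hkl ?_
    refine GaussianInt.finsupp_eq_of_im_eq_zero hprime (fun p q hpq h ↦ ?_) (fun p q h ↦ ?_) him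
    · have := GaussianInt.natAbs_norm_dvd h
      rw [hnorm', hnorm'] at this
      exact hne p q hpq this
    · have h1 := GaussianInt.natAbs_norm_dvd h
      rw [Zsqrtd.norm_conj, hnorm', hnorm'] at h1
      by_cases hpq : p = q
      · subst hpq
        exact GaussianInt.not_dvd_star p.2.1 p.2.2 (ha p) ((ha p).trans (hab p)) (hpab p) h
      · exact hne p q hpq h1

end

theorem theorem6 :
    (∃ G : Set ℝ, (∀ g ∈ G, Irrational g) ∧ IsDenseLacunary G) ∧
    ((∀ g ∈ quadraticGenerators, Irrational g) ∧ IsDenseLacunary quadraticGenerators) ∧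
    ((∀ g ∈ gaussianGenerators, Transcendental ℚ g) ∧ IsDenseLacunary gaussianGenerators) :=
  ⟨⟨_, quadraticGenerators_irrational, isDenseLacunary_quadraticGenerators⟩,
    ⟨quadraticGenerators_irrational, isDenseLacunary_quadraticGenerators⟩,
    gaussianGenerators_transcendental, isDenseLacunary_gaussianGenerators⟩
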